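/- Let $n\ge 0$ and work with real $n\times n$ matrices. Let $B$ and $B_-$ be the groups of invertible upper and lower triangular matrices, $N\subset B$ and $N_-\subset B_-$ the subgroups of unipotent ones, $H$ the group of invertible diagonal matrices, and $G_0=N_-HN$; for $x\in G_0$ write $x=[x]_-[x]_0[x]_+$ for its unique factorization with $[x]_-\in N_-$, $[x]_0\in H$, $[x]_+\in N$. Identify $w\in\mathcal S_n$ with the permutation matrix sending $e_j$ to $e_{w(j)}$, and let $\le$ be the Bruhat order: $u\le v$ iff $B_-uB_-\subset\overline{B_-vB_-}$. Put $N(w)=w^{-1}Bw\cap N$ and $N_-(w)=w^{-1}Bw\cap N_-$. Let $Y$ be the monoid of totally nonnegative elements of $N$, generated by the matrices $x_i(t)$, $t\ge 0$, $1\le i\le n-1$, where $x_i(t)$ differs from the identity only by the entry $t$ in position $(i,i+1)$. Put $Y^\circ_w=Y\cap B_-wB_-$ and $Y_{\ge u}=\bigcup_{v\ge u}Y^\circ_v$. Fix $u\in\mathcal S_n$ and $x_u\in Y^\circ_u$. Let $\pi_u\colon Y_{\ge u}\to Y^\circ_u$ be the projection $\pi_u(x)=[u[u^{-1}[xu^{-1}]_+u]_-]_+$.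 For $x\in Y_{\ge u}$ let $\rho_{x_u}(x)=[xm]_+$, where $m$ is the unique element of $N_-(u)$ such that $xm\in G_0$ and $[xm]_+\in x_uN(u)$. For $\tau>0$ let $d(\tau)=\tau^{-(n-1)/2}\,\mathrm{diag}(\tau^{n-1},\tau^{n-2},\dots,1)$, and for $x\in\pi_u^{-1}(x_u)$ let $$\psi(x)=\frac{d}{d\tau}\,\rho_{x_u}\bigl(d(\tau)\,x\,d(\tau)^{-1}\bigr)\Big|_{\tau=1}.$$ Let $\mathrm{str}(x)=\sum_{i=1}^{n-1}x_{i,i+1}$. Then $\psi$ is well defined on the fiber $\pi_u^{-1}(x_u)$ (for $x$ in the fiber and $\tau>0$ one has $d(\tau)xd(\tau)^{-1}\in Y_{\ge u}$, the element $m$ for it exists and is unique, and the derivative exists); the point $x_u$ lies in the fiber, and it is the only point of the fiber at which $\psi$ vanishes; and the directional derivative $\nabla_\psi\,\mathrm{str}(x)$ is positive at every point $x\ne x_u$ of $\pi_u^{-1}(x_u)$. -/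

import Mathlib

noncomputable section

namespace TNNLink

/-- Real `n × n` matrices. All groups below are sets of such matrices. -/
abbrev Mat (n : ℕ) : Type := Matrix (Fin n) (Fin n) ℝ

/-! ### Triangular subgroups, permutation matrices and the Bruhat decomposition of `GL(n, ℝ)` -/

/-- `B`: invertible upper triangular matrices. -/
def B (n : ℕ) : Set (Mat n) :=
  {b | (∀ i j, j < i → b i j = 0) ∧ ∀ i, b i i ≠ 0}

/-- `B₋`: invertible lower triangular matrices. -/
def Bminus (n : ℕ) : Set (Mat n) :=
  {b | (∀ i j, i < j → b i j = 0) ∧ ∀ i, b i i ≠ 0}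

/-- `N`: unipotent upper triangular matrices. -/
def N (n : ℕ) : Set (Mat n) :=
  {b | (∀ i j, j < i → b i j = 0) ∧ ∀ i, b i i = 1}

/-- `N₋`: unipotent lower triangular matrices. -/
def Nminus (n : ℕ) : Set (Mat n) :=
  {b | (∀ i j, i < j → b i j = 0) ∧ ∀ i, b i i = 1}

/-- `H`: invertible diagonal matrices. -/
def H (n : ℕ) : Set (Mat n) :=
  {h | (∀ i j, i ≠ j → h i j = 0) ∧ ∀ i, h i i ≠ 0}

/-- The permutation matrix of `w`, sending the basis vector `e_j` to `e_{w(j)}`: its entry `(i, j)`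
is `1` if `i = w j` and `0` otherwise. (Mathlib's `permMatrix` uses the inverse convention.) Thus
`perm (u * w) = perm u * perm w`, and `perm w⁻¹` is the inverse matrix of `perm w`. -/
def perm {n : ℕ} (w : Equiv.Perm (Fin n)) : Mat n :=
  (w⁻¹).permMatrix ℝ

/-- The Bruhat cell `B₋ w B₋`. -/
def bruhatCell {n : ℕ} (w : Equiv.Perm (Fin n)) : Set (Mat n) :=
  {x | ∃ b ∈ Bminus n, ∃ b' ∈ Bminus n, x = b * perm w * b'}

/-- The Bruhat order, defined geometrically: `u ≤ v` iff `B₋ u B₋` is contained in the closure of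
`B₋ v B₋`. -/
def bruhatLE {n : ℕ} (u v : Equiv.Perm (Fin n)) : Prop :=
  bruhatCell u ⊆ closure (bruhatCell v)

/-- `N₋(w) = w⁻¹ B w ∩ N₋`. -/
def NminusOf {n : ℕ} (w : Equiv.Perm (Fin n)) : Set (Mat n) :=
  {z | perm w * z * perm w⁻¹ ∈ B n} ∩ Nminus n

/-- `N(w) = w⁻¹ B w ∩ N`. -/
def NOf {n : ℕ} (w : Equiv.Perm (Fin n)) : Set (Mat n) :=
  {z | perm w * z * perm w⁻¹ ∈ B n} ∩ N n

/-! ### Gaussian decomposition -/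

/-- `p = (a, h, b)` is a Gaussian decomposition of `x`: `x = a h b` with `a ∈ N₋`, `h ∈ H`,
`b ∈ N`. It is unique when it exists. -/
def IsGauss {n : ℕ} (x : Mat n) (p : Mat n × Mat n × Mat n) : Prop :=
  p.1 ∈ Nminus n ∧ p.2.1 ∈ H n ∧ p.2.2 ∈ N n ∧ x = p.1 * p.2.1 * p.2.2

/-- `G₀ = N₋ H N`. -/
def G0 (n : ℕ) : Set (Mat n) :=
  {x | ∃ p, IsGauss x p}

open Classical in
/-- `[x]₋`, for `x ∈ G₀` (and `0` otherwise). -/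
def gaussMinus {n : ℕ} (x : Mat n) : Mat n :=
  if h : ∃ p, IsGauss x p then h.choose.1 else 0

open Classical in
/-- `[x]₊`, for `x ∈ G₀` (and `0` otherwise). -/
def gaussPlus {n : ℕ} (x : Mat n) : Mat n :=
  if h : ∃ p, IsGauss x p then h.choose.2.2 else 0

/-! ### Totally nonnegative unipotent matrices and their cells -/

/-- `Y`: the monoid generated by the matrices `x_i(t)` with `t ≥ 0`, where `x_i(t)` differs from
the identity only by the entry `t` in row `i` and column `i + 1`. -/
def Y (n : ℕ) : Submonoid (Mat n) :=
  Submonoid.closure {x | ∃ (i : Fin n) (h : i.val + 1 < n) (t : ℝ), 0 ≤ t ∧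
    x = Matrix.transvection i ⟨i.val + 1, h⟩ t}

/-- The cell `Y°_w = Y ∩ B₋ w B₋`. -/
def Ycell {n : ℕ} (w : Equiv.Perm (Fin n)) : Set (Mat n) :=
  (Y n : Set (Mat n)) ∩ bruhatCell w

/-- `Y_{≥ u}`, the union of the cells `Y°_v` over `v ≥ u`. -/
def Ygeq {n : ℕ} (u : Equiv.Perm (Fin n)) : Set (Mat n) :=
  {x | ∃ v, bruhatLE u v ∧ x ∈ Ycell v}

/-! ### The two projections -/

/-- `π_u(x) = [u [u⁻¹ [x u⁻¹]₊ u]₋]₊`. -/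
def piProj {n : ℕ} (u : Equiv.Perm (Fin n)) (x : Mat n) : Mat n :=
  gaussPlus (perm u * gaussMinus (perm u⁻¹ * gaussPlus (x * perm u⁻¹) * perm u))

/-- The fiber `π_u⁻¹(x_u)` of `π_u : Y_{≥ u} → Y°_u`. -/
def fiber {n : ℕ} (u : Equiv.Perm (Fin n)) (xu : Mat n) : Set (Mat n) :=
  {x | x ∈ Ygeq u ∧ piProj u x = xu}

/-- `m` is the element of `N₋(u)` that moves `x` into `x_u N(u)`: the element `[x m]₊` is well
defined and belongs to `x_u N(u)`. -/
def IsShift {n : ℕ} (u : Equiv.Perm (Fin n)) (xu x m : Mat n) : Prop :=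
  m ∈ NminusOf u ∧ x * m ∈ G0 n ∧ ∃ z ∈ NOf u, gaussPlus (x * m) = xu * z

open Classical in
/-- `ρ_{x_u}(x) = [x m]₊`, where `m` is the element of `N₋(u)` such that `[x m]₊` is well defined
and belongs to `x_u N(u)` (and `0` if there is none). -/
def rho {n : ℕ} (u : Equiv.Perm (Fin n)) (xu x : Mat n) : Mat n :=
  if h : ∃ m, IsShift u xu x m then gaussPlus (x * h.choose) else 0

/-! ### The torus scaling, the vector field and the function `str` -/

/-- `d(τ) = τ^{-(n-1)/2} diag(τ^{n-1}, τ^{n-2}, …, 1)`, for `τ > 0`. -/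
def torus (n : ℕ) (τ : ℝ) : Mat n :=
  τ ^ (-((n : ℝ) - 1) / 2) • Matrix.diagonal (fun i : Fin n => τ ^ (n - 1 - i.val))

/-- `d(τ) x d(τ)⁻¹`. -/
def scale {n : ℕ} (τ : ℝ) (x : Mat n) : Mat n :=
  torus n τ * x * (torus n τ)⁻¹

/-- `ψ(x)`, the derivative of `ρ_{x_u}(d(τ) x d(τ)⁻¹)` with respect to `τ` at `τ = 1`. -/
def psi {n : ℕ} (u : Equiv.Perm (Fin n)) (xu x : Mat n) : Mat n :=
  deriv (fun τ : ℝ => rho u xu (scale τ x)) 1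

/-- `str(x)`, the sum of the entries immediately above the main diagonal. -/
def str {n : ℕ} (x : Mat n) : ℝ :=
  ∑ i : Fin n, if h : i.val + 1 < n then x i ⟨i.val + 1, h⟩ else 0

end TNNLink

end

noncomputable section

namespace TNNLink

open Matrix

/-! Write `x u⁻¹ = c a` with `c ∈ B₋`, `a ∈ N`, and split `g = u⁻¹ a u = l z` into a lower and an
upper unipotent factor. Unwinding `π_u` gives `x_u = c u l` and `x = x_u z`. Conjugation by `d(τ)`
alters the left factor only inside `B₋` and replaces `g` by `g(τ) = d(τ) g d(τ)⁻¹`. Hence the shift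
`m` is determined by `l⁻¹ g(τ) = z(τ) m⁻¹`, an upper times a lower unipotent matrix, and `ρ = x_u
z(τ)`. Differentiating at `τ = 1` yields `ψ(x) = x S`, where `S` is the strictly upper part of `g⁻¹
D g` and `D = diag(0, -1, -2, …)`. As `x` is unipotent, the derivative of `str` along `ψ` is the sum
of the superdiagonal entries of `g⁻¹ D g`.

With `q = u(i)` and `r = u(i+1)`, such an entry is the sum over `p` of `(a⁻¹)_{qp} a_{pr}
(-u⁻¹(p))`. The products `(a⁻¹)_{qp} a_{pr}` sum to zero, so the weight may be replaced by `i + 1/2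
- u⁻¹(p)`. Every term is then nonnegative (`PermFactor.term_nonneg`): up to sign, entries of `a` and
of `a⁻¹` are ratios of flag minors of `x`, and total nonnegativity fixes their signs. If `x ≠ x_u`,
some term is nonzero (`PermFactor.exists_term_ne_zero`).

Both this nonvanishing and the existence of the factorization `c a` rest on `FlagNonneg.down`: on
`Y`, the nonvanishing of flag minors passes downward in the Gale order. At `x_u` the matrix `g = l`
is lower triangular, so `ψ = 0`; elsewhere positivity of the derivative of `str` excludes a zero. -/

/-! ### Unitriangular matrices with respect to an ordering of the indices -/

/-- Matrices with unit diagonal that are upper triangular for the order on indices pulled back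
along `b`. -/
def unitri {n : ℕ} {α : Type*} [LinearOrder α] (b : Fin n → α) : Set (Mat n) :=
  {z | BlockTriangular z b ∧ ∀ i, z i i = 1}

/-- An injective `b` pulls back to a linear order on the indices, for which `A` is triangular in the
ordinary sense. -/
lemma det_of_blockTriangular_injective {m α : Type*} [Fintype m] [DecidableEq m] [LinearOrder α]
    {A : Matrix m m ℝ} {b : m → α} (hb : Function.Injective b) (hA : BlockTriangular A b) :
    A.det = ∏ i, A i i := by
  let : LinearOrder m := LinearOrder.lift' b hb
  have hA' : A.IsUpperTriangular := fun i j hij => hA hij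
  rw [← Matrix.det_of_isUpperTriangular hA']

section
variable {n : ℕ} {α : Type*} [LinearOrder α] {b : Fin n → α}

lemma diag_mul_of_blockTriangular (hb : Function.Injective b) {A C : Mat n}
    (hA : BlockTriangular A b) (hC : BlockTriangular C b) (i : Fin n) :
    (A * C) i i = A i i * C i i := by
  rw [Matrix.mul_apply, Finset.sum_eq_single i]
  · intro k _ hk
    rcases lt_trichotomy (b k) (b i) with h | h | h
    · rw [hA h, zero_mul]
    · exact absurd (hb h) hk
    · rw [hC h, mul_zero]
  · simp

lemma det_ne_zero_of_blockTriangular (hb : Function.Injective b) {A : Mat n}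
    (hA : BlockTriangular A b) (hd : ∀ i, A i i ≠ 0) : A.det ≠ 0 := by
  rw [det_of_blockTriangular_injective hb hA]
  exact Finset.prod_ne_zero_iff.2 fun i _ => hd i

lemma inv_mul_self_of_det {A : Mat n} (h : A.det ≠ 0) : A⁻¹ * A = 1 :=
  nonsing_inv_mul A (isUnit_iff_ne_zero.2 h)

lemma mul_inv_self_of_det {A : Mat n} (h : A.det ≠ 0) : A * A⁻¹ = 1 :=
  mul_nonsing_inv A (isUnit_iff_ne_zero.2 h)

lemma blockTriangular_inv {A : Mat n} (hA : BlockTriangular A b) (h : A.det ≠ 0) :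
    BlockTriangular A⁻¹ b := by
  have := A.invertibleOfIsUnitDet (isUnit_iff_ne_zero.2 h)
  exact blockTriangular_inv_of_blockTriangular hA

lemma diag_inv_of_blockTriangular (hb : Function.Injective b) {A : Mat n}
    (hA : BlockTriangular A b) (h : A.det ≠ 0) (i : Fin n) : A⁻¹ i i * A i i = 1 := by
  rw [← diag_mul_of_blockTriangular hb (blockTriangular_inv hA h) hA, inv_mul_self_of_det h,
    one_apply_eq]

lemma unitri.det_ne_zero (hb : Function.Injective b) {A : Mat n} (hA : A ∈ unitri b) :
    A.det ≠ 0 :=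
  det_ne_zero_of_blockTriangular hb hA.1 fun i => by rw [hA.2 i]; exact one_ne_zero

lemma unitri.mul (hb : Function.Injective b) {A C : Mat n} (hA : A ∈ unitri b)
    (hC : C ∈ unitri b) : A * C ∈ unitri b :=
  ⟨hA.1.mul hC.1, fun i => by rw [diag_mul_of_blockTriangular hb hA.1 hC.1, hA.2, hC.2, one_mul]⟩

lemma unitri.inv (hb : Function.Injective b) {A : Mat n} (hA : A ∈ unitri b) :
    A⁻¹ ∈ unitri b := by
  have h := unitri.det_ne_zero hb hA
  refine ⟨blockTriangular_inv hA.1 h, fun i => ?_⟩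
  have := diag_inv_of_blockTriangular hb hA.1 h i
  rwa [hA.2, mul_one] at this

lemma unitri.inv_mul_self (hb : Function.Injective b) {A : Mat n} (hA : A ∈ unitri b) :
    A⁻¹ * A = 1 := inv_mul_self_of_det (unitri.det_ne_zero hb hA)

lemma unitri.mul_inv_self (hb : Function.Injective b) {A : Mat n} (hA : A ∈ unitri b) :
    A * A⁻¹ = 1 := mul_inv_self_of_det (unitri.det_ne_zero hb hA)

lemma unitri.one : (1 : Mat n) ∈ unitri b :=
  ⟨blockTriangular_one, fun i => one_apply_eq i⟩

end

/-! ### The group `B₋` and factorizations in `B₋ N` -/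

section
variable {n : ℕ}

lemma toDual_inj : Function.Injective (OrderDual.toDual : Fin n → (Fin n)ᵒᵈ) :=
  OrderDual.toDual.injective

lemma Bminus.det_ne_zero {c : Mat n} (hc : c ∈ Bminus n) : c.det ≠ 0 :=
  det_ne_zero_of_blockTriangular toDual_inj (fun i j h => hc.1 i j h) hc.2

lemma Bminus.mul {c d : Mat n} (hc : c ∈ Bminus n) (hd : d ∈ Bminus n) : c * d ∈ Bminus n := by
  have h1 : BlockTriangular c OrderDual.toDual := fun i j h => hc.1 i j h
  have h2 : BlockTriangular d OrderDual.toDual := fun i j h => hd.1 i j h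
  refine ⟨fun i j h => (h1.mul h2) h, fun i => ?_⟩
  rw [diag_mul_of_blockTriangular toDual_inj h1 h2]
  exact mul_ne_zero (hc.2 i) (hd.2 i)

lemma Bminus.inv {c : Mat n} (hc : c ∈ Bminus n) : c⁻¹ ∈ Bminus n := by
  have h1 : BlockTriangular c OrderDual.toDual := fun i j h => hc.1 i j h
  have h := Bminus.det_ne_zero hc
  refine ⟨fun i j hij => (blockTriangular_inv h1 h) hij, fun i hi => ?_⟩
  have := diag_inv_of_blockTriangular toDual_inj h1 h i
  rw [hi, zero_mul] at this
  exact zero_ne_one this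

lemma Nminus_subset_Bminus {c : Mat n} (hc : c ∈ Nminus n) : c ∈ Bminus n :=
  ⟨hc.1, fun i => by rw [hc.2]; exact one_ne_zero⟩

lemma eq_one_of_mem_Bminus_of_mem_N {c : Mat n} (h : c ∈ Bminus n) (h' : c ∈ N n) : c = 1 := by
  ext i j
  rcases lt_trichotomy i j with hij | rfl | hij
  · rw [h.1 _ _ hij, one_apply_ne hij.ne]
  · rw [h'.2, one_apply_eq]
  · rw [h'.1 _ _ hij, one_apply_ne hij.ne']

/-- Uniqueness of the factorization in `B₋ N`. -/
lemma Bminus_mul_N_unique {c c' a a' : Mat n} (hc : c ∈ Bminus n) (hc' : c' ∈ Bminus n)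
    (ha : a ∈ N n) (ha' : a' ∈ N n) (h : c * a = c' * a') : c = c' ∧ a = a' := by
  have hi := Function.injective_id (α := Fin n)
  have key : c'⁻¹ * c = a' * a⁻¹ := by
    calc c'⁻¹ * c = c'⁻¹ * (c * (a * a⁻¹)) := by rw [unitri.mul_inv_self hi ha, mul_one]
      _ = c'⁻¹ * c' * a' * a⁻¹ := by rw [← mul_assoc c, h]; simp only [mul_assoc]
      _ = a' * a⁻¹ := by rw [inv_mul_self_of_det (Bminus.det_ne_zero hc'), one_mul]
  have h1 : a' * a⁻¹ = 1 := eq_one_of_mem_Bminus_of_mem_N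
    (key ▸ Bminus.mul (Bminus.inv hc') hc) (unitri.mul hi ha' (unitri.inv hi ha))
  have h2 : a' = a := by
    calc a' = a' * (a⁻¹ * a) := by rw [unitri.inv_mul_self hi ha, mul_one]
      _ = a := by rw [← mul_assoc, h1, one_mul]
  subst h2
  refine ⟨?_, rfl⟩
  calc c = c * a' * a'⁻¹ := by rw [mul_assoc, unitri.mul_inv_self hi ha, mul_one]
    _ = c' := by rw [h, mul_assoc, unitri.mul_inv_self hi ha, mul_one]

/-! ### Gaussian decomposition -/

lemma H_subset_Bminus {c : Mat n} (hc : c ∈ H n) : c ∈ Bminus n :=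
  ⟨fun i j h => hc.1 i j h.ne, hc.2⟩

/-- Since `B₋ = N₋ H`, three-term Gaussian decompositions can be traded for two-term factorizations
in `B₋ N`, the form used from here on. -/
lemma isGauss_of_mem_Bminus {c a : Mat n} (hc : c ∈ Bminus n) (ha : a ∈ N n) :
    ∃ p, IsGauss (c * a) p := by
  refine ⟨(c * diagonal fun i => (c i i)⁻¹, diagonal fun i => c i i, a), ⟨?_, ?_⟩, ⟨?_, ?_⟩, ha, ?_⟩
  · intro i j hij
    simp [hc.1 i j hij]
  · intro i
    simp [hc.2 i]
  · intro i j hij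
    simp [diagonal_apply_ne _ hij]
  · intro i
    simpa using hc.2 i
  · congr 1
    rw [mul_assoc, diagonal_mul_diagonal]
    have : (fun i => (c i i)⁻¹ * c i i) = fun _ => (1 : ℝ) := by
      funext i
      exact inv_mul_cancel₀ (hc.2 i)
    rw [this, diagonal_one, mul_one]

lemma mul_mem_G0 {c a : Mat n} (hc : c ∈ Bminus n) (ha : a ∈ N n) : c * a ∈ G0 n :=
  isGauss_of_mem_Bminus hc ha

lemma gaussPlus_mul {c a : Mat n} (hc : c ∈ Bminus n) (ha : a ∈ N n) :
    gaussPlus (c * a) = a := by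
  have h := isGauss_of_mem_Bminus hc ha
  rw [gaussPlus, dif_pos h]
  obtain ⟨h1, h2, h3, h4⟩ := h.choose_spec
  exact (Bminus_mul_N_unique (Bminus.mul (Nminus_subset_Bminus h1) (H_subset_Bminus h2)) hc h3 ha
    h4.symm).2

lemma exists_eq_mul_gaussPlus {x : Mat n} (hx : x ∈ G0 n) :
    ∃ c ∈ Bminus n, gaussPlus x ∈ N n ∧ x = c * gaussPlus x := by
  obtain ⟨⟨l, d, a⟩, h1, h2, h3, h4⟩ := hx
  have hc := Bminus.mul (Nminus_subset_Bminus h1) (H_subset_Bminus h2)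
  refine ⟨_, hc, ?_⟩
  rw [h4, gaussPlus_mul hc h3]
  exact ⟨h3, rfl⟩

lemma gaussMinus_mul {l a : Mat n} (hl : l ∈ Nminus n) (ha : a ∈ N n) :
    gaussMinus (l * a) = l := by
  have h := isGauss_of_mem_Bminus (Nminus_subset_Bminus hl) ha
  rw [gaussMinus, dif_pos h]
  obtain ⟨h1, h2, h3, h4⟩ := h.choose_spec
  set p := h.choose
  have hpl := (Bminus_mul_N_unique (Bminus.mul (Nminus_subset_Bminus h1) (H_subset_Bminus h2))
    (Nminus_subset_Bminus hl) h3 ha h4.symm).1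
  -- Both `l` and the `N₋` factor have unit diagonal, so comparing diagonals leaves no room for a
  -- torus factor.
  have hd : p.2.1 = 1 := by
    ext i j
    by_cases hij : i = j
    · subst hij
      have := diag_mul_of_blockTriangular toDual_inj (A := p.1) (C := p.2.1)
        (fun i j h => h1.1 i j h) (fun i j h => (H_subset_Bminus h2).1 i j h) i
      rw [hpl, hl.2, h1.2, one_mul] at this
      rw [← this, one_apply_eq]
    · rw [h2.1 i j hij, one_apply_ne hij]
  rw [← hpl, hd, mul_one]

/-! ### Column elimination -/

/-- If the diagonal blocks of `y` along the index sets `S j` are invertible, then column operations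
adding to column `j` multiples of the columns in `S j` kill the entries of `y` in column `j` and
rows in `S j`. -/
lemma exists_column_elimination (y : Mat n) (S : Fin n → Finset (Fin n)) (hS : ∀ j, j ∉ S j)
    (hdet : ∀ j, (y.submatrix ((↑) : S j → Fin n) (↑)).det ≠ 0) :
    ∃ a : Mat n, (∀ j, a j j = 1) ∧ (∀ i j, i ≠ j → i ∉ S j → a i j = 0) ∧
      ∀ j, ∀ i ∈ S j, (y * a) i j = 0 := by
  -- The coefficients for column `j` solve a square linear system whose matrix is the block indexed
  -- by `S j`.
  have hsol : ∀ j, ∃ w : S j → ℝ, ∀ i : S j, ∑ k : S j, y i k * w k = - y i j := by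
    intro j
    let A : Matrix (S j) (S j) ℝ := y.submatrix Subtype.val Subtype.val
    refine ⟨A⁻¹ *ᵥ fun i : S j => - y i j, fun i => ?_⟩
    have : A *ᵥ (A⁻¹ *ᵥ fun i : S j => - y i j) = fun i : S j => - y i j := by
      rw [mulVec_mulVec, mul_nonsing_inv A (isUnit_iff_ne_zero.2 (hdet j)), one_mulVec]
    exact congrFun this i
  choose w hw using hsol
  refine ⟨Matrix.of fun i j => if i = j then 1 else if h : i ∈ S j then w j ⟨i, h⟩ else 0, ?_, ?_, ?_⟩
  · intro j; simp
  · intro i j h h'; simp [h, h']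
  · intro j i hi
    rw [Matrix.mul_apply]
    simp only [of_apply]
    have h1 : ∀ k, y i k * (if k = j then 1 else if h : k ∈ S j then w j ⟨k, h⟩ else 0)
        = (if k = j then y i j else 0) + (if h : k ∈ S j then y i k * w j ⟨k, h⟩ else 0) := by
      intro k
      by_cases hk : k = j
      · subst hk; simp [hS]
      · simp only [hk, if_false, zero_add]
        split_ifs <;> simp
    rw [Finset.sum_congr rfl fun k _ => h1 k, Finset.sum_add_distrib, Finset.sum_ite_eq' ,
      if_pos (Finset.mem_univ _)]
    have h2 : ∑ k, (if h : k ∈ S j then y i k * w j ⟨k, h⟩ else 0) = ∑ k : S j, y i k * w j k := by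
      symm
      refine Fintype.sum_of_injective ((↑) : S j → Fin n) Subtype.val_injective _ _ ?_ ?_
      · intro k hk
        rw [dif_neg]
        intro h
        exact hk ⟨⟨k, h⟩, rfl⟩
      · intro k
        rw [dif_pos k.2]
    rw [h2, hw j ⟨i, hi⟩, add_neg_cancel]

/-- The group `unitri b` is the product of its lower and upper unitriangular subgroups. -/
lemma unitri.exists_lower_mul_upper {α : Type*} [LinearOrder α] {b : Fin n → α}
    (hb : Function.Injective b) {g : Mat n} (hg : g ∈ unitri b) :
    ∃ l ∈ unitri b ∩ Nminus n, ∃ z ∈ unitri b ∩ N n, g = l * z := by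
  -- Only columns preceding `j` in both orders are added to column `j`, so `a` is unitriangular for
  -- both. The other entries above the diagonal have `b i > b j` and vanish already.
  obtain ⟨a, ha1, ha2, ha3⟩ := exists_column_elimination g
    (fun j => Finset.univ.filter fun i => i < j ∧ b i < b j) (by simp) (by
      intro j
      rw [det_of_blockTriangular_injective (b := b ∘ Subtype.val) (hb.comp Subtype.val_injective)
        (by intro i k h; exact hg.1 h)]
      refine Finset.prod_ne_zero_iff.2 fun i _ => ?_
      rw [submatrix_apply, hg.2]
      exact one_ne_zero)
  have hab : a ∈ unitri b := by
    refine ⟨fun i j h => ha2 i j (by rintro rfl; exact lt_irrefl _ h) ?_, ha1⟩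
    simp [h.le]
  have haN : a ∈ N n := by
    refine ⟨fun i j h => ha2 i j h.ne' ?_, ha1⟩
    simp [h.le]
  have hga : g * a ∈ unitri b := unitri.mul hb hg hab
  refine ⟨g * a, ⟨hga, ⟨fun i j hij => ?_, hga.2⟩⟩, a⁻¹, ⟨unitri.inv hb hab,
    unitri.inv Function.injective_id haN⟩, ?_⟩
  · rcases lt_trichotomy (b i) (b j) with h | h | h
    · exact ha3 j i (by simp [hij, h])
    · exact absurd (hb h) hij.ne
    · exact hga.1 h
  · rw [mul_assoc, unitri.mul_inv_self hb hab, mul_one]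

/-- The leading principal submatrix of size `p`. -/
def leading (p : ℕ) (hp : p ≤ n) (y : Mat n) : Matrix (Fin p) (Fin p) ℝ :=
  y.submatrix (Fin.castLE hp) (Fin.castLE hp)

/-- Column elimination with `S j = {i | i < j}`: the blocks to invert are leading principal
submatrices, and `p = n` keeps the diagonal of the resulting lower triangular matrix nonzero. -/
lemma exists_Bminus_mul_N {y : Mat n} (h : ∀ p (hp : p ≤ n), (leading p hp y).det ≠ 0) :
    ∃ c ∈ Bminus n, ∃ a ∈ N n, y = c * a := by
  obtain ⟨a, ha1, ha2, ha3⟩ := exists_column_elimination y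
    (fun j => Finset.univ.filter fun i => i < j) (by simp) (by
      intro j
      have := h j.1 j.2.le
      let e : Fin j.1 ≃ {i // i ∈ Finset.univ.filter fun i => i < j} :=
        { toFun := fun k => ⟨Fin.castLE j.2.le k, by
            simp only [Finset.mem_filter, Finset.mem_univ, true_and]
            exact k.2⟩
          invFun := fun i => ⟨i.1.1, by
            have := i.2
            simp only [Finset.mem_filter, Finset.mem_univ, true_and] at this
            exact this⟩
          left_inv := fun k => rfl
          right_inv := fun i => rfl }
      rw [← det_submatrix_equiv_self e]
      exact this)
  have haN : a ∈ N n := by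
    refine ⟨fun i j h => ha2 i j h.ne' ?_, ha1⟩
    simp [h.le]
  have hdet : (y * a).det ≠ 0 := by
    rw [det_mul]
    refine mul_ne_zero ?_ (unitri.det_ne_zero Function.injective_id haN)
    exact h n le_rfl
  have hlow : ∀ i j, i < j → (y * a) i j = 0 := fun i j hij => ha3 j i (by simp [hij])
  have hdiag : ∀ i, (y * a) i i ≠ 0 := by
    rw [det_of_blockTriangular_injective toDual_inj (fun i j h => hlow i j h)] at hdet
    exact fun i => Finset.prod_ne_zero_iff.1 hdet i (Finset.mem_univ _)
  refine ⟨y * a, ⟨hlow, hdiag⟩, a⁻¹, unitri.inv Function.injective_id haN, ?_⟩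
  rw [mul_assoc, unitri.mul_inv_self Function.injective_id haN, mul_one]

/-! ### Permutation matrices -/

lemma perm_apply (w : Equiv.Perm (Fin n)) (i j : Fin n) :
    perm w i j = if i = w j then 1 else 0 := by
  simp only [perm, Equiv.Perm.permMatrix, PEquiv.toMatrix_apply, Equiv.toPEquiv_apply,
    Option.mem_def, Option.some.injEq, Equiv.Perm.inv_eq_iff_eq]

lemma mul_perm_apply (x : Mat n) (w : Equiv.Perm (Fin n)) (i j : Fin n) :
    (x * perm w) i j = x i (w j) := by
  simp [Matrix.mul_apply, perm_apply]

lemma perm_mul_apply (x : Mat n) (w : Equiv.Perm (Fin n)) (i j : Fin n) :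
    (perm w * x) i j = x (w⁻¹ i) j := by
  have : ∀ k, (i = w k) ↔ (w⁻¹ i = k) := fun k => (Equiv.Perm.inv_eq_iff_eq).symm
  simp [Matrix.mul_apply, perm_apply, this]

lemma perm_mul_perm_inv (w : Equiv.Perm (Fin n)) : perm w * perm w⁻¹ = 1 := by
  ext i j
  rw [perm_mul_apply, perm_apply, one_apply]
  simp

lemma perm_inv_mul_perm (w : Equiv.Perm (Fin n)) : perm w⁻¹ * perm w = 1 := by
  simpa using perm_mul_perm_inv w⁻¹

lemma conj_mem_B_iff {u : Equiv.Perm (Fin n)} {z : Mat n} (hz : ∀ i, z i i = 1) :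
    perm u * z * perm u⁻¹ ∈ B n ↔ z ∈ unitri u := by
  have h : ∀ i j, (perm u * z * perm u⁻¹) i j = z (u⁻¹ i) (u⁻¹ j) := fun i j => by
    rw [mul_perm_apply, perm_mul_apply]
  constructor
  · rintro ⟨h1, -⟩
    refine ⟨fun i j hij => ?_, hz⟩
    have := h1 (u i) (u j) hij
    rw [h] at this
    simpa using this
  · rintro ⟨h1, -⟩
    refine ⟨fun i j hij => ?_, fun i => ?_⟩
    · rw [h]
      exact h1 (by simpa using hij)
    · rw [h, hz]
      exact one_ne_zero

lemma NminusOf_eq (u : Equiv.Perm (Fin n)) : NminusOf u = unitri u ∩ Nminus n := by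
  ext z
  exact and_congr_left fun h => conj_mem_B_iff h.2

lemma NOf_eq (u : Equiv.Perm (Fin n)) : NOf u = unitri u ∩ N n := by
  ext z
  exact and_congr_left fun h => conj_mem_B_iff h.2

lemma conj_mem_N {u : Equiv.Perm (Fin n)} {z : Mat n} (hz : z ∈ unitri u) :
    perm u * z * perm u⁻¹ ∈ N n := by
  refine ⟨((conj_mem_B_iff hz.2).2 hz).1, fun i => ?_⟩
  rw [mul_perm_apply, perm_mul_apply, hz.2]

lemma conj_inv_mem_unitri {u : Equiv.Perm (Fin n)} {a : Mat n} (ha : a ∈ N n) :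
    perm u⁻¹ * a * perm u ∈ unitri u := by
  have h : ∀ i j, (perm u⁻¹ * a * perm u) i j = a (u i) (u j) := fun i j => by
    rw [mul_perm_apply, perm_mul_apply, inv_inv]
  exact ⟨fun i j hij => by rw [h]; exact ha.1 _ _ hij, fun i => by rw [h, ha.2]⟩

end

section
variable {n p : ℕ}

/-! ### Flag minors -/

/-- The minor of `x` on the first `p` rows and the columns `s 0, …, s (p - 1)`, in this order. -/
def flagMinor (hp : p ≤ n) (s : Fin p → Fin n) (x : Mat n) : ℝ :=
  (x.submatrix (Fin.castLE hp) s).det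

/-- The Vandermonde determinant of the sequence `s`; its sign is that of the permutation
sorting `s`. -/
def vdm (s : Fin p → Fin n) : ℝ := (vandermonde fun a => ((s a : ℕ) : ℝ)).det

lemma injective_cast_iff {s : Fin p → Fin n} :
    Function.Injective (fun a => ((s a : ℕ) : ℝ)) ↔ Function.Injective s := by
  refine ⟨fun h a c hac => h (by simp [hac]), fun h a c hac => h ?_⟩
  exact Fin.ext (by simpa using hac)

lemma vdm_ne_zero {s : Fin p → Fin n} (hs : Function.Injective s) : vdm s ≠ 0 :=
  det_vandermonde_ne_zero_iff.2 (injective_cast_iff.2 hs)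

lemma flagMinor_eq_zero_of_not_injective (hp : p ≤ n) {s : Fin p → Fin n}
    (hs : ¬ Function.Injective s) (x : Mat n) : flagMinor hp s x = 0 := by
  simp only [Function.Injective, not_forall] at hs
  obtain ⟨a, c, h, hac⟩ := hs
  exact det_zero_of_column_eq hac fun i => by simp [h]

lemma injective_of_flagMinor_ne_zero {hp : p ≤ n} {s : Fin p → Fin n} {x : Mat n}
    (h : flagMinor hp s x ≠ 0) : Function.Injective s := by
  by_contra hs
  exact h (flagMinor_eq_zero_of_not_injective hp hs x)

/-- The first `p` rows of `c * x` involve only the first `p` rows of `x`, so the minor factors with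
no Cauchy–Binet sum. -/
lemma flagMinor_lower_mul (hp : p ≤ n) (s : Fin p → Fin n) {c : Mat n}
    (hc : ∀ i j, i < j → c i j = 0) (x : Mat n) :
    flagMinor hp s (c * x) = (leading p hp c).det * flagMinor hp s x := by
  rw [flagMinor, flagMinor, leading, ← det_mul]
  congr 1
  ext i j
  rw [submatrix_apply, Matrix.mul_apply, Matrix.mul_apply]
  symm
  refine Fintype.sum_of_injective (Fin.castLE hp) (Fin.castLE_injective hp) _ _ ?_ fun k => rfl
  intro k hk
  have hk' : Fin.castLE hp i < k := by
    by_contra hle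
    refine hk ⟨⟨k, ?_⟩, rfl⟩
    have : (k : ℕ) ≤ i := not_lt.1 hle
    omega
  rw [hc _ _ hk', zero_mul]

lemma flagMinor_mul_perm (hp : p ≤ n) (s : Fin p → Fin n) (x : Mat n)
    (w : Equiv.Perm (Fin n)) : flagMinor hp s (x * perm w) = flagMinor hp (w ∘ s) x := by
  rw [flagMinor, flagMinor]
  congr 1
  ext i j
  rw [submatrix_apply, mul_perm_apply, submatrix_apply]
  rfl

lemma det_leading_ne_zero (hp : p ≤ n) {c : Mat n} (hc : c ∈ Bminus n) :
    (leading p hp c).det ≠ 0 := by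
  rw [det_of_blockTriangular_injective (b := fun i : Fin p => OrderDual.toDual i)
    (OrderDual.toDual.injective) (by intro i j h; exact hc.1 _ _ h)]
  exact Finset.prod_ne_zero_iff.2 fun i _ => hc.2 _

lemma continuous_flagMinor (hp : p ≤ n) (s : Fin p → Fin n) : Continuous (flagMinor hp s) :=
  Continuous.matrix_det (continuous_id.matrix_submatrix _ _)

/-! ### Signs of sequences -/

/-- The term at `a` is moved to the front and split off. The sign and the remaining determinant do
not depend on `v a`, so they cancel when sequences differing only at `a` are compared. -/
lemma vandermonde_det_cons_swap {m : ℕ} (v : Fin (m + 1) → ℝ) (a : Fin (m + 1)) :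
    (vandermonde v).det = (Equiv.Perm.sign (Equiv.swap 0 a) : ℝ) *
      ((∏ j : Fin m, (v (Equiv.swap 0 a j.succ) - v a)) *
        (vandermonde fun j : Fin m => v (Equiv.swap 0 a j.succ)).det) := by
  have h1 : (vandermonde (v ∘ Equiv.swap 0 a)).det
      = (Equiv.Perm.sign (Equiv.swap 0 a) : ℝ) * (vandermonde v).det := by
    rw [← det_permute]
    rfl
  have h2 : (vandermonde (v ∘ Equiv.swap 0 a)).det
      = (∏ j : Fin m, (v (Equiv.swap 0 a j.succ) - v a)) *
        (vandermonde fun j : Fin m => v (Equiv.swap 0 a j.succ)).det := by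
    rw [det_vandermonde, Fin.prod_univ_succ, det_vandermonde]
    congr 1
    · rw [Fin.prod_Ioi_zero]
      simp
    · refine Finset.prod_congr rfl fun i _ => ?_
      rw [Fin.prod_Ioi_succ]
      rfl
  rw [← h2, h1, ← mul_assoc]
  have : ((Equiv.Perm.sign (Equiv.swap 0 a) : ℤ) : ℝ) * (Equiv.Perm.sign (Equiv.swap 0 a) : ℤ) = 1 := by
    rw [← Int.cast_mul, ← Units.val_mul, Int.units_mul_self]
    simp
  rw [this, one_mul]

lemma prod_erase_eq_prod_swap_succ {m : ℕ} (f : Fin (m + 1) → ℝ) (a : Fin (m + 1)) :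
    ∏ b ∈ Finset.univ.erase a, f b = ∏ j : Fin m, f (Equiv.swap 0 a j.succ) := by
  have h1 : ∏ b, Function.update f a 1 b = ∏ b ∈ Finset.univ.erase a, f b := by
    rw [← Finset.mul_prod_erase _ _ (Finset.mem_univ a), Function.update_self, one_mul]
    exact Finset.prod_congr rfl fun b hb => Function.update_of_ne (Finset.ne_of_mem_erase hb) _ _
  rw [← h1, ← Equiv.prod_comp (Equiv.swap 0 a), Fin.prod_univ_succ, Equiv.swap_apply_left,
    Function.update_self, one_mul]
  refine Finset.prod_congr rfl fun j _ => Function.update_of_ne ?_ _ _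
  intro h
  have := (Equiv.swap 0 a).injective (h.trans (Equiv.swap_apply_left 0 a).symm)
  exact Fin.succ_ne_zero j this

/-- Replacing one term of a sequence changes its Vandermonde determinant by an explicit sign. -/
lemma vdm_update_mul_vdm_nonneg (s : Fin p → Fin n) (a : Fin p) (k : Fin n) :
    0 ≤ vdm (Function.update s a k) * vdm s *
      ∏ b ∈ Finset.univ.erase a, (((s a : ℕ) : ℝ) - (s b : ℕ)) * (((k : ℕ) : ℝ) - (s b : ℕ)) := by
  obtain ⟨m, rfl⟩ : ∃ m, p = m + 1 := ⟨p - 1, by have := a.2; omega⟩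
  rw [prod_erase_eq_prod_swap_succ, vdm, vdm, vandermonde_det_cons_swap _ a,
    vandermonde_det_cons_swap (fun b => ((s b : ℕ) : ℝ)) a]
  have hne : ∀ j : Fin m, Equiv.swap 0 a j.succ ≠ a := by
    intro j h
    have := (Equiv.swap 0 a).injective (h.trans (Equiv.swap_apply_left 0 a).symm)
    exact Fin.succ_ne_zero j this
  simp only [Function.update_of_ne (hne _), Function.update_self]
  set W := (vandermonde fun j : Fin m => ((s (Equiv.swap 0 a j.succ) : ℕ) : ℝ)).det
  rw [Finset.prod_mul_distrib]
  have e : ∀ c : ℝ, ∏ j : Fin m, (c - ((s (Equiv.swap 0 a j.succ) : ℕ) : ℝ))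
      = (-1) ^ m * ∏ j : Fin m, (((s (Equiv.swap 0 a j.succ) : ℕ) : ℝ) - c) := by
    intro c
    rw [← Fin.prod_const, ← Finset.prod_mul_distrib]
    exact Finset.prod_congr rfl fun j _ => by ring
  rw [e, e]
  generalize ∏ j : Fin m, (((s (Equiv.swap 0 a j.succ) : ℕ) : ℝ) - ((k : ℕ) : ℝ)) = A
  generalize ∏ j : Fin m, (((s (Equiv.swap 0 a j.succ) : ℕ) : ℝ) - ((s a : ℕ) : ℝ)) = C
  generalize (Equiv.Perm.sign (Equiv.swap 0 a) : ℝ) = ε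
  have : ε * (A * W) * (ε * (C * W)) * ((-1) ^ m * C * ((-1) ^ m * A))
      = (ε * A * W * C * (-1) ^ m) ^ 2 := by ring
  rw [this]
  exact sq_nonneg _

/-! ### Gale order on column sequences -/

/-- The number of terms of `s` that are at least `j`. -/
def countGE (s : Fin p → Fin n) (j : ℕ) : ℕ :=
  (Finset.univ.filter fun a => j ≤ (s a : ℕ)).card

lemma countGE_mono {s t : Fin p → Fin n} (h : ∀ a, s a ≤ t a) (j : ℕ) :
    countGE s j ≤ countGE t j := by
  refine Finset.card_le_card fun a ha => ?_
  simp only [Finset.mem_filter, Finset.mem_univ, true_and] at ha ⊢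
  exact ha.trans (h a)

lemma countGE_update (s : Fin p → Fin n) (a : Fin p) (k : Fin n) (j : ℕ) :
    countGE (Function.update s a k) j + (if j ≤ (s a : ℕ) then 1 else 0)
      = countGE s j + (if j ≤ (k : ℕ) then 1 else 0) := by
  simp only [countGE, Finset.card_filter]
  rw [← Finset.add_sum_erase _ _ (Finset.mem_univ a),
    ← Finset.add_sum_erase _ (fun b => if j ≤ (s b : ℕ) then 1 else 0) (Finset.mem_univ a),
    Function.update_self, Finset.sum_congr rfl fun b hb => by
      rw [Function.update_of_ne (Finset.ne_of_mem_erase hb)]]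
  omega

lemma countGE_succ_of_notMem {s : Fin p → Fin n} {j : ℕ} (h : ∀ a, (s a : ℕ) ≠ j) :
    countGE s j = countGE s (j + 1) := by
  rw [countGE, countGE]
  congr 1
  ext a
  have := h a
  simp only [Finset.mem_filter, Finset.mem_univ, true_and]
  omega

lemma countGE_succ_of_eq {s : Fin p → Fin n} (hs : Function.Injective s) {j : ℕ} {a : Fin p}
    (h : (s a : ℕ) = j) : countGE s j = countGE s (j + 1) + 1 := by
  rw [countGE, countGE, ← Finset.card_insert_of_notMem (a := a)]
  · congr 1
    ext b
    simp only [Finset.mem_filter, Finset.mem_univ, true_and, Finset.mem_insert]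
    constructor
    · intro hb
      rcases eq_or_ne b a with hba | hba
      · exact Or.inl hba
      · right
        have : (s b : ℕ) ≠ s a := fun e => hba (hs (Fin.ext e))
        omega
    · rintro (rfl | hb) <;> omega
  · simp [h]

/-! ### Total nonnegativity -/

/-- All flag minors on increasing sequences of columns are nonnegative, and the sets of columns
with nonzero flag minor are closed downward in the Gale order. -/
structure FlagNonneg (x : Mat n) : Prop where
  nonneg : ∀ (p : ℕ) (hp : p ≤ n) (s : Fin p → Fin n), 0 ≤ vdm s * flagMinor hp s x
  down : ∀ (p : ℕ) (hp : p ≤ n) (s t : Fin p → Fin n), Function.Injective t →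
    (∀ j, countGE t j ≤ countGE s j) → flagMinor hp s x ≠ 0 → flagMinor hp t x ≠ 0


lemma flagMinor_one_eq_zero (hp : p ≤ n) {s : Fin p → Fin n} {a : Fin p} (ha : p ≤ (s a : ℕ)) :
    flagMinor hp s 1 = 0 := by
  refine det_eq_zero_of_column_eq_zero a fun i => ?_
  rw [submatrix_apply, one_apply_ne]
  intro h
  have h' := congrArg Fin.val h
  simp only [Fin.val_castLE] at h'
  omega

lemma exists_perm_of_lt (hp : p ≤ n) {s : Fin p → Fin n} (hs : Function.Injective s)
    (h : ∀ a, (s a : ℕ) < p) : ∃ σ : Equiv.Perm (Fin p), s = Fin.castLE hp ∘ σ := by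
  have hinj : Function.Injective fun a : Fin p => (⟨s a, h a⟩ : Fin p) := by
    intro a c hac
    exact hs (Fin.ext (by simpa using hac))
  exact ⟨Equiv.ofBijective _ (Finite.injective_iff_bijective.1 hinj), by ext a; rfl⟩

lemma flagMinor_comp_perm (hp : p ≤ n) (s : Fin p → Fin n) (σ : Equiv.Perm (Fin p)) (x : Mat n) :
    flagMinor hp (s ∘ σ) x = (Equiv.Perm.sign σ : ℝ) * flagMinor hp s x := by
  rw [flagMinor, flagMinor, ← det_permute']
  rfl

lemma vdm_comp_perm (s : Fin p → Fin n) (σ : Equiv.Perm (Fin p)) :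
    vdm (s ∘ σ) = (Equiv.Perm.sign σ : ℝ) * vdm s := by
  rw [vdm, vdm, ← det_permute]
  rfl

lemma vdm_pos_of_strictMono {s : Fin p → Fin n} (hs : StrictMono s) : 0 < vdm s := by
  rw [vdm, det_vandermonde]
  refine Finset.prod_pos fun i _ => Finset.prod_pos fun j hj => sub_pos.2 ?_
  exact_mod_cast hs (Finset.mem_Ioi.1 hj)

lemma flagMinor_castLE_one (hp : p ≤ n) : flagMinor hp (Fin.castLE hp) 1 = 1 := by
  rw [flagMinor, submatrix_one _ (Fin.castLE_injective hp), det_one]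

lemma sign_mul_self_real (σ : Equiv.Perm (Fin p)) :
    ((Equiv.Perm.sign σ : ℤ) : ℝ) * (Equiv.Perm.sign σ : ℤ) = 1 := by
  rw [← Int.cast_mul, ← Units.val_mul, Int.units_mul_self]
  simp

/-- The nonzero minors of the identity are those whose columns permute the first `p`, the minimum of
the Gale order. -/
lemma FlagNonneg.one : FlagNonneg (1 : Mat n) where
  nonneg p hp s := by
    by_cases hs : Function.Injective s
    · by_cases h : ∀ a, (s a : ℕ) < p
      · obtain ⟨σ, rfl⟩ := exists_perm_of_lt hp hs h
        rw [flagMinor_comp_perm, vdm_comp_perm, flagMinor_castLE_one, mul_one, mul_right_comm,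
          sign_mul_self_real, one_mul]
        exact (vdm_pos_of_strictMono (Fin.strictMono_castLE hp)).le
      · push Not at h
        obtain ⟨a, ha⟩ := h
        rw [flagMinor_one_eq_zero hp ha, mul_zero]
    · rw [flagMinor_eq_zero_of_not_injective hp hs, mul_zero]
  down p hp s t ht hts h := by
    have hs : countGE s p = 0 := by
      rw [countGE, Finset.card_eq_zero, Finset.filter_eq_empty_iff]
      exact fun a _ ha => h (flagMinor_one_eq_zero hp ha)
    have htp : countGE t p = 0 := Nat.le_zero.1 (hs ▸ hts p)
    rw [countGE, Finset.card_eq_zero, Finset.filter_eq_empty_iff] at htp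
    obtain ⟨σ, rfl⟩ := exists_perm_of_lt hp ht fun a => not_le.1 (htp (Finset.mem_univ a))
    rw [flagMinor_comp_perm, flagMinor_castLE_one, mul_one]
    intro h0
    have := sign_mul_self_real σ
    rw [h0, mul_zero] at this
    exact zero_ne_one this

lemma flagMinor_mul_transvection_of_notMem (hp : p ≤ n) {s : Fin p → Fin n} {i j : Fin n}
    (h : ∀ a, s a ≠ j) (c : ℝ) (y : Mat n) :
    flagMinor hp s (y * transvection i j c) = flagMinor hp s y := by
  rw [flagMinor, flagMinor]
  congr 1
  ext k a
  rw [submatrix_apply, submatrix_apply, mul_transvection_apply_of_ne _ _ _ _ (h a)]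

/-- Multilinearity in the column at `a`; injectivity of `s` ensures that no other selected column is
altered. -/
lemma flagMinor_mul_transvection (hp : p ≤ n) {s : Fin p → Fin n} (hs : Function.Injective s)
    {i j : Fin n} {a : Fin p} (ha : s a = j) (c : ℝ) (y : Mat n) :
    flagMinor hp s (y * transvection i j c)
      = flagMinor hp s y + c * flagMinor hp (Function.update s a i) y := by
  have h1 : (y * transvection i j c).submatrix (Fin.castLE hp) s
      = (y.submatrix (Fin.castLE hp) s).updateCol a
        ((fun k => y (Fin.castLE hp k) j) + c • fun k => y (Fin.castLE hp k) i) := by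
    ext k b
    by_cases hb : b = a
    · subst hb
      rw [submatrix_apply, ha, mul_transvection_apply_same, updateCol_self]
      rfl
    · rw [submatrix_apply, updateCol_ne hb, submatrix_apply, mul_transvection_apply_of_ne]
      exact fun h => hb (hs (h.trans ha.symm))
  have h2 : (y.submatrix (Fin.castLE hp) s).updateCol a (fun k => y (Fin.castLE hp k) j)
      = y.submatrix (Fin.castLE hp) s := by
    ext k b
    by_cases hb : b = a
    · subst hb
      rw [submatrix_apply, updateCol_self, ha]
    · rw [updateCol_ne hb]
  have h3 : (y.submatrix (Fin.castLE hp) s).updateCol a (fun k => y (Fin.castLE hp k) i)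
      = y.submatrix (Fin.castLE hp) (Function.update s a i) := by
    ext k b
    by_cases hb : b = a
    · subst hb
      rw [submatrix_apply, updateCol_self, Function.update_self]
    · rw [updateCol_ne hb, submatrix_apply, submatrix_apply, Function.update_of_ne hb]
  rw [flagMinor, h1, det_updateCol_add, det_updateCol_smul, h2, h3]
  rfl

lemma not_injective_update {s : Fin p → Fin n} {a b : Fin p} (hab : b ≠ a) :
    ¬ Function.Injective (Function.update s a (s b)) := by
  intro h
  refine hab (h ?_)
  rw [Function.update_of_ne hab, Function.update_self]

/-- Replacing `i + 1` by `i` in a sequence not containing `i` does not change its sign. -/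
lemma vdm_update_mul_vdm_pos {s : Fin p → Fin n} (hs : Function.Injective s) {a : Fin p}
    {i : Fin n} (ha : (s a : ℕ) = i + 1) (hi : ∀ b, s b ≠ i) :
    0 < vdm (Function.update s a i) * vdm s := by
  have h := vdm_update_mul_vdm_nonneg s a i
  have hpos : 0 < ∏ b ∈ Finset.univ.erase a,
      (((s a : ℕ) : ℝ) - (s b : ℕ)) * (((i : ℕ) : ℝ) - (s b : ℕ)) := by
    refine Finset.prod_pos fun b hb => ?_
    have h1 : (s b : ℕ) ≠ i := fun e => hi b (Fin.ext e)
    have h2 : (s b : ℕ) ≠ s a := fun e => (Finset.ne_of_mem_erase hb) (hs (Fin.ext e))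
    rcases lt_or_gt_of_ne h1 with h3 | h3
    · refine mul_pos (sub_pos.2 ?_) (sub_pos.2 ?_)
      · exact_mod_cast (by omega : (s b : ℕ) < s a)
      · exact_mod_cast h3
    · refine mul_pos_of_neg_of_neg (sub_neg.2 ?_) (sub_neg.2 ?_)
      · exact_mod_cast (by omega : (s a : ℕ) < s b)
      · exact_mod_cast h3
  have hinj : Function.Injective (Function.update s a i) := by
    intro b c hbc
    by_cases hb : b = a <;> by_cases hc : c = a
    · rw [hb, hc]
    · subst hb
      rw [Function.update_self, Function.update_of_ne hc] at hbc
      exact absurd hbc.symm (hi c)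
    · subst hc
      rw [Function.update_self, Function.update_of_ne hb] at hbc
      exact absurd hbc (hi b)
    · rw [Function.update_of_ne hb, Function.update_of_ne hc] at hbc
      exact hs hbc
  have h0 : 0 ≤ vdm (Function.update s a i) * vdm s := nonneg_of_mul_nonneg_left h hpos
  exact lt_of_le_of_ne h0 (mul_ne_zero (vdm_ne_zero hinj) (vdm_ne_zero hs)).symm

/-- If `i` already occurs in `s`, the new minor has a repeated column; otherwise replacing `i + 1`
by `i` preserves the sorting sign. -/
lemma vdm_mul_flagMinor_update_nonneg {y : Mat n} (hy : FlagNonneg y) (hp : p ≤ n)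
    {s : Fin p → Fin n} (hs : Function.Injective s) {i : Fin n} {a : Fin p}
    (ha : (s a : ℕ) = i + 1) : 0 ≤ vdm s * flagMinor hp (Function.update s a i) y := by
  by_cases hi : ∀ b, s b ≠ i
  · have h1 := vdm_update_mul_vdm_pos hs ha hi
    have h2 := mul_nonneg h1.le (hy.nonneg p hp (Function.update s a i))
    have h3 : vdm (Function.update s a i) ≠ 0 := left_ne_zero_of_mul h1.ne'
    have h4 : vdm (Function.update s a i) * vdm s *
        (vdm (Function.update s a i) * flagMinor hp (Function.update s a i) y)
        = vdm (Function.update s a i) ^ 2 * (vdm s * flagMinor hp (Function.update s a i) y) := by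
      ring
    rw [h4] at h2
    exact nonneg_of_mul_nonneg_right h2 (by positivity)
  · push Not at hi
    obtain ⟨b, rfl⟩ := hi
    rw [flagMinor_eq_zero_of_not_injective hp (not_injective_update _), mul_zero]
    rintro rfl
    omega

/-- Flag minors can only grow, up to the sign of the sequence, under multiplication by `x_i(c)`. -/
lemma FlagNonneg.le_mul_transvection {y : Mat n} (hy : FlagNonneg y) {i j : Fin n}
    (hij : (j : ℕ) = i + 1) {c : ℝ} (hc : 0 ≤ c) (hp : p ≤ n) (s : Fin p → Fin n) :
    vdm s * flagMinor hp s y ≤ vdm s * flagMinor hp s (y * transvection i j c) := by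
  by_cases hs : Function.Injective s
  · by_cases h : ∀ a, s a ≠ j
    · rw [flagMinor_mul_transvection_of_notMem hp h]
    · push Not at h
      obtain ⟨a, ha⟩ := h
      rw [flagMinor_mul_transvection hp hs ha, mul_add, mul_left_comm]
      exact le_add_of_nonneg_right
        (mul_nonneg hc (vdm_mul_flagMinor_update_nonneg hy hp hs (ha ▸ hij)))
  · rw [flagMinor_eq_zero_of_not_injective hp hs, flagMinor_eq_zero_of_not_injective hp hs]

lemma FlagNonneg.mul_transvection {y : Mat n} (hy : FlagNonneg y) {i j : Fin n}
    (hij : (j : ℕ) = i + 1) {c : ℝ} (hc : 0 ≤ c) : FlagNonneg (y * transvection i j c) where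
  nonneg p hp s := (hy.nonneg p hp s).trans (hy.le_mul_transvection hij hc hp s)
  down p hp s t ht hts h := by
    have grow : ∀ r : Fin p → Fin n, flagMinor hp r y ≠ 0 →
        flagMinor hp r (y * transvection i j c) ≠ 0 := by
      intro r hr h0
      have h1 := hy.le_mul_transvection hij hc hp r
      rw [h0, mul_zero] at h1
      exact mul_ne_zero (vdm_ne_zero (injective_of_flagMinor_ne_zero hr)) hr
        (le_antisymm h1 (hy.nonneg p hp r))
    by_cases hsy : flagMinor hp s y ≠ 0
    · exact grow t (hy.down p hp s t ht hts hsy)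
    push Not at hsy
    have hs := injective_of_flagMinor_ne_zero h
    obtain ⟨a, ha⟩ : ∃ a, s a = j := by
      by_contra hne
      push Not at hne
      rw [flagMinor_mul_transvection_of_notMem hp hne] at h
      exact h hsy
    rw [flagMinor_mul_transvection hp hs ha, hsy, zero_add] at h
    have hc' : c ≠ 0 := left_ne_zero_of_mul h
    have hup := right_ne_zero_of_mul h
    have hi : ∀ b, s b ≠ i := by
      rintro b rfl
      refine not_injective_update (a := a) (b := b) ?_ (injective_of_flagMinor_ne_zero hup)
      rintro rfl
      rw [ha] at hij
      omega
    -- Lowering the column `j = i + 1` to `i` changes the counting function only at the threshold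
    -- `j`.
    have hcs : ∀ k, countGE (Function.update s a i) k + (if k = (j : ℕ) then 1 else 0)
        = countGE s k := by
      intro k
      have := countGE_update s a i k
      rw [ha] at this
      split_ifs at this ⊢ <;> omega
    -- With room to spare at the threshold `j`, `t` already lies below the lowered sequence.
    by_cases hle : countGE t j < countGE s j
    · refine grow t (hy.down p hp _ t ht (fun k => ?_) hup)
      have h1 := hcs k
      have h2 := hts k
      split_ifs at h1 with hk
      · subst hk; omega
      · omega
    -- Equality at `j` forces `t`, like `s`, to contain `j` and omit `i`. Lowering `t` in the same
    -- way then puts it below the lowered `s`.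
    have hts' : countGE t j = countGE s j := le_antisymm (hts j) (not_lt.1 hle)
    have hti : ∀ b, t b ≠ i := by
      intro b hb
      have h1 := countGE_succ_of_eq ht (congrArg Fin.val hb)
      have h2 := countGE_succ_of_notMem (s := s) (j := i) fun b e => hi b (Fin.ext e)
      have h3 := hts i
      rw [← hij] at h1 h2
      omega
    obtain ⟨b, hb⟩ : ∃ b, t b = j := by
      by_contra hne
      push Not at hne
      have h1 := countGE_succ_of_notMem (s := t) (j := j) fun b e => hne b (Fin.ext e)
      have h2 := countGE_succ_of_eq hs (congrArg Fin.val ha)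
      have h3 := hts (j + 1)
      omega
    have htj : ((t b : Fin n) : ℕ) = i + 1 := hb ▸ hij
    have hpos := vdm_update_mul_vdm_pos ht htj hti
    have hinj : Function.Injective (Function.update t b i) := by
      by_contra hn
      refine (left_ne_zero_of_mul hpos.ne') ?_
      by_contra h0
      exact hn (injective_cast_iff.1 (det_vandermonde_ne_zero_iff.1 h0))
    have hne : flagMinor hp (Function.update t b i) y ≠ 0 := by
      refine hy.down p hp _ _ hinj (fun k => ?_) hup
      have h1 := hcs k
      have h2 := countGE_update t b i k
      rw [hb] at h2
      have h3 := hts k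
      split_ifs at h1 h2 <;> omega
    have h1 := hy.nonneg p hp t
    have h2 := vdm_mul_flagMinor_update_nonneg hy hp ht htj
    have h3 : vdm t * flagMinor hp (Function.update t b i) y ≠ 0 :=
      mul_ne_zero (vdm_ne_zero ht) hne
    -- After multiplication by `vdm t` both summands are nonnegative and the second is positive, so
    -- no cancellation can occur.
    rw [flagMinor_mul_transvection hp ht hb]
    intro h0
    have h4 : vdm t * flagMinor hp t y + c * (vdm t * flagMinor hp (Function.update t b i) y) = 0 := by
      rw [mul_left_comm, ← mul_add, h0, mul_zero]
    have h5 : 0 < c * (vdm t * flagMinor hp (Function.update t b i) y) :=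
      mul_pos (lt_of_le_of_ne hc hc'.symm) (lt_of_le_of_ne h2 h3.symm)
    linarith

lemma flagNonneg_of_mem_Y {x : Mat n} (hx : x ∈ Y n) : FlagNonneg x := by
  refine Submonoid.closure_induction_right (motive := fun x _ => FlagNonneg x) FlagNonneg.one
    ?_ hx
  rintro y - _ ⟨i, h, t, ht, rfl⟩ hy
  exact hy.mul_transvection rfl ht

lemma mem_N_of_mem_Y {x : Mat n} (hx : x ∈ Y n) : x ∈ N n := by
  refine Submonoid.closure_induction (motive := fun x _ => x ∈ N n) ?_ unitri.one
    (fun a c _ _ ha hc => unitri.mul Function.injective_id ha hc) hx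
  rintro _ ⟨i, h, t, ht, rfl⟩
  refine ⟨fun k l hkl => ?_, fun k => ?_⟩
  · rw [transvection, Matrix.add_apply, one_apply_ne hkl.ne', zero_add, single_apply, if_neg]
    rintro ⟨rfl, rfl⟩
    rw [Fin.lt_def] at hkl
    simp at hkl
  · rw [transvection, Matrix.add_apply, one_apply_eq, single_apply, if_neg, add_zero]
    rintro ⟨rfl, h'⟩
    have := congrArg Fin.val h'
    simp at this

/-! ### Flag minors on Bruhat cells -/

/-- The first `p` terms of the sequence `w⁻¹(0), w⁻¹(1), …`. -/
def initialSeq (w : Equiv.Perm (Fin n)) (hp : p ≤ n) : Fin p → Fin n :=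
  ⇑w⁻¹ ∘ Fin.castLE hp

lemma initialSeq_injective (w : Equiv.Perm (Fin n)) (hp : p ≤ n) :
    Function.Injective (initialSeq w hp) :=
  (Equiv.injective _).comp (Fin.castLE_injective hp)

lemma flagMinor_perm_mul (hp : p ≤ n) (w : Equiv.Perm (Fin n)) (s : Fin p → Fin n) (y : Mat n) :
    flagMinor hp s (perm w * y) = (y.submatrix (initialSeq w hp) s).det := by
  rw [flagMinor]
  congr 1
  ext i j
  rw [submatrix_apply, perm_mul_apply, submatrix_apply]
  rfl

/-- On these columns the minor of the right factor is principal, hence triangular after reordering.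
-/
lemma flagMinor_initialSeq_ne_zero (hp : p ≤ n) {w : Equiv.Perm (Fin n)} {x : Mat n}
    (hx : x ∈ bruhatCell w) : flagMinor hp (initialSeq w hp) x ≠ 0 := by
  obtain ⟨c, hc, d, hd, rfl⟩ := hx
  rw [mul_assoc, flagMinor_lower_mul hp _ hc.1, flagMinor_perm_mul]
  refine mul_ne_zero (det_leading_ne_zero hp hc) ?_
  rw [det_of_blockTriangular_injective
    (toDual_inj.comp (initialSeq_injective w hp)) (by intro i j h; exact hd.1 _ _ h)]
  exact Finset.prod_ne_zero_iff.2 fun i _ => hd.2 _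

/-- A nonzero term of the Leibniz expansion matches each selected column with a row index at least
as large, by lower triangularity of the right factor. -/
lemma countGE_le_of_flagMinor_ne_zero (hp : p ≤ n) {w : Equiv.Perm (Fin n)} {x : Mat n}
    (hx : x ∈ bruhatCell w) {s : Fin p → Fin n} (h : flagMinor hp s x ≠ 0) (j : ℕ) :
    countGE s j ≤ countGE (initialSeq w hp) j := by
  obtain ⟨c, hc, d, hd, rfl⟩ := hx
  rw [mul_assoc, flagMinor_lower_mul hp _ hc.1, flagMinor_perm_mul] at h
  have h' := right_ne_zero_of_mul h
  rw [det_apply] at h'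
  obtain ⟨σ, -, hσ⟩ := Finset.exists_ne_zero_of_sum_ne_zero h'
  have hprod : ∏ i, d (initialSeq w hp (σ i)) (s i) ≠ 0 := fun h0 => hσ (by
    simp only [submatrix_apply]
    rw [h0, smul_zero])
  rw [Finset.prod_ne_zero_iff] at hprod
  refine Finset.card_le_card_of_injOn σ (fun a ha => ?_) (σ.injective.injOn)
  simp only [Finset.coe_filter, Finset.mem_univ, true_and, Set.mem_ofPred_eq] at ha ⊢
  refine ha.trans ?_
  by_contra hlt
  exact hprod a (Finset.mem_univ a) (hd.1 _ _ (not_le.1 hlt))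

lemma perm_mem_bruhatCell (w : Equiv.Perm (Fin n)) : perm w ∈ bruhatCell w := by
  have h1 : (1 : Mat n) ∈ Bminus n := Nminus_subset_Bminus (unitri.one (b := OrderDual.toDual))
  exact ⟨1, h1, 1, h1, by rw [one_mul, mul_one]⟩

/-- Vanishing of a flag minor is a closed condition: if it held on the cell of `v`, it would hold at
the matrix of `u`. -/
lemma countGE_le_of_bruhatLE (hp : p ≤ n) {u v : Equiv.Perm (Fin n)} (h : bruhatLE u v) (j : ℕ) :
    countGE (initialSeq u hp) j ≤ countGE (initialSeq v hp) j := by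
  by_contra hlt
  have hsub : bruhatCell v ⊆ {x | flagMinor hp (initialSeq u hp) x = 0} := by
    intro x hx
    by_contra h0
    exact hlt (countGE_le_of_flagMinor_ne_zero hp hx h0 j)
  have hcl : IsClosed {x | flagMinor hp (initialSeq u hp) x = 0} :=
    isClosed_eq (continuous_flagMinor hp _) continuous_const
  have := closure_minimal hsub hcl (h (perm_mem_bruhatCell u))
  exact flagMinor_initialSeq_ne_zero hp (perm_mem_bruhatCell u) this

/-- The corresponding minor for `v` is nonzero on its cell, and `u ≤ v` makes the columns for `u`
Gale-smaller. -/
lemma flagMinor_ne_zero_of_mem_Ygeq (hp : p ≤ n) {u : Equiv.Perm (Fin n)} {x : Mat n}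
    (hx : x ∈ Ygeq u) : flagMinor hp (initialSeq u hp) x ≠ 0 := by
  obtain ⟨v, huv, hxY, hxv⟩ := hx
  exact (flagNonneg_of_mem_Y hxY).down p hp _ _ (initialSeq_injective u hp)
    (countGE_le_of_bruhatLE hp huv) (flagMinor_initialSeq_ne_zero hp hxv)

end

section
variable {n : ℕ}

/-! ### Entries of the unipotent factor and of its inverse -/

/-- The submatrix is upper triangular with diagonal `1, …, 1, a p r`. -/
lemma flagMinor_update_last {a : Mat n} (ha : a ∈ N n) (p r : Fin n) :
    flagMinor (Nat.succ_le_of_lt p.2)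
      (Function.update (Fin.castLE (Nat.succ_le_of_lt p.2)) (Fin.last p) r) a = a p r := by
  rw [flagMinor, det_of_blockTriangular_injective (b := id) Function.injective_id,
    Fin.prod_univ_castSucc]
  · rw [Finset.prod_eq_one, one_mul, submatrix_apply, Function.update_self]
    · congr 1
    · intro i _
      rw [submatrix_apply, Function.update_of_ne (Fin.castSucc_lt_last i).ne]
      exact ha.2 _
  · intro i j hij
    have hj : j ≠ Fin.last p := ((show j < i from hij).trans_le (Fin.le_last i)).ne
    rw [submatrix_apply, Function.update_of_ne hj]
    exact ha.1 _ _ hij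

lemma flagMinor_castLE_of_mem_N {a : Mat n} (ha : a ∈ N n) {p : ℕ} (hp : p ≤ n) :
    flagMinor hp (Fin.castLE hp) a = 1 := by
  rw [flagMinor, det_of_blockTriangular_injective (b := id) Function.injective_id]
  · exact Finset.prod_eq_one fun i _ => ha.2 _
  · intro i j hij
    exact ha.1 _ _ hij

/-- Cramer's rule: on the first `p` rows, column `p` of `a` combines the preceding columns with
coefficients `-a⁻¹ · p`, and the leading minor is `1`. -/
lemma flagMinor_update_castLE {a : Mat n} (ha : a ∈ N n) {p q : Fin n} (hqp : q < p) :
    flagMinor p.2.le (Function.update (Fin.castLE p.2.le) ⟨q, hqp⟩ p) a = - a⁻¹ q p := by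
  have hi := Function.injective_id (α := Fin n)
  set A := a.submatrix (Fin.castLE p.2.le) (Fin.castLE p.2.le) with hA
  have hdet : A.det = 1 := flagMinor_castLE_of_mem_N ha p.2.le
  set w : Fin p → ℝ := fun k => - a⁻¹ (Fin.castLE p.2.le k) p with hw
  have hAw : A *ᵥ w = fun k => a (Fin.castLE p.2.le k) p := by
    funext k
    have h1 : (a * a⁻¹) (Fin.castLE p.2.le k) p = 0 := by
      rw [unitri.mul_inv_self hi ha, one_apply_ne]
      intro h
      have := congrArg Fin.val h
      simp only [Fin.val_castLE] at this
      exact absurd this k.2.ne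
    rw [Matrix.mul_apply, ← Finset.add_sum_erase _ _ (Finset.mem_univ p),
      (unitri.inv hi ha).2, mul_one] at h1
    have h2 : ∑ l ∈ Finset.univ.erase p, a (Fin.castLE p.2.le k) l * a⁻¹ l p
        = ∑ l : Fin p, a (Fin.castLE p.2.le k) (Fin.castLE p.2.le l) *
          a⁻¹ (Fin.castLE p.2.le l) p := by
      symm
      refine Finset.sum_of_injOn (Fin.castLE p.2.le) (Fin.castLE_injective _).injOn ?_ ?_
        fun l _ => rfl
      · intro l _
        simp only [Finset.coe_erase, Finset.coe_univ, Set.mem_sdiff, Set.mem_univ,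
          Set.mem_singleton_iff, true_and]
        intro h
        have := congrArg Fin.val h
        simp only [Fin.val_castLE] at this
        exact absurd this l.2.ne
      · intro l hl hl'
        have hpl : p < l := by
          rcases lt_trichotomy l p with h | h | h
          · exact absurd ⟨⟨l, h⟩, by simp, rfl⟩ hl'
          · exact absurd h (Finset.ne_of_mem_erase hl)
          · exact h
        rw [(unitri.inv hi ha).1 hpl, mul_zero]
    rw [h2] at h1
    simp only [mulVec, dotProduct, hA, hw, submatrix_apply, mul_neg, Finset.sum_neg_distrib]
    linarith
  have hup : a.submatrix (Fin.castLE p.2.le) (Function.update (Fin.castLE p.2.le) ⟨q, hqp⟩ p)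
      = A.updateCol ⟨q, hqp⟩ (A *ᵥ w) := by
    rw [hAw]
    ext k l
    by_cases hl : l = ⟨q, hqp⟩
    · subst hl
      rw [submatrix_apply, Function.update_self, updateCol_self]
    · rw [submatrix_apply, Function.update_of_ne hl, updateCol_ne hl, hA, submatrix_apply]
  rw [flagMinor, hup, ← cramer_apply, cramer_eq_adjugate_mulVec, mulVec_mulVec, adjugate_mul,
    hdet, one_smul, one_mulVec]
  rfl

/-- The unipotent factor of `x u⁻¹`, for `x ∈ Y_{≥ u}`. -/
structure PermFactor (u : Equiv.Perm (Fin n)) (x c a : Mat n) : Prop where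
  flag : FlagNonneg x
  lower : c ∈ Bminus n
  upper : a ∈ N n
  eq : x * perm u⁻¹ = c * a

variable {u : Equiv.Perm (Fin n)} {x c a : Mat n}

lemma PermFactor.flagMinor_comp (h : PermFactor u x c a) {p : ℕ} (hp : p ≤ n)
    (s : Fin p → Fin n) :
    flagMinor hp (⇑u⁻¹ ∘ s) x = (leading p hp c).det * flagMinor hp s a := by
  rw [← flagMinor_mul_perm, h.eq, flagMinor_lower_mul hp s h.lower.1]

lemma PermFactor.flagMinor_initialSeq (h : PermFactor u x c a) {p : ℕ} (hp : p ≤ n) :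
    flagMinor hp (initialSeq u hp) x = (leading p hp c).det := by
  rw [initialSeq, h.flagMinor_comp hp, flagMinor_castLE_of_mem_N h.upper, mul_one]

lemma PermFactor.flagMinor_initialSeq_ne_zero (h : PermFactor u x c a) {p : ℕ} (hp : p ≤ n) :
    flagMinor hp (initialSeq u hp) x ≠ 0 := by
  rw [h.flagMinor_initialSeq hp]
  exact det_leading_ne_zero hp h.lower

lemma PermFactor.entry (h : PermFactor u x c a) (p r : Fin n) :
    flagMinor (Nat.succ_le_of_lt p.2)
      (Function.update (initialSeq u (Nat.succ_le_of_lt p.2)) (Fin.last p) (u⁻¹ r)) x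
      = flagMinor (Nat.succ_le_of_lt p.2) (initialSeq u (Nat.succ_le_of_lt p.2)) x * a p r := by
  rw [h.flagMinor_initialSeq, ← flagMinor_update_last h.upper p r, ← h.flagMinor_comp,
    Function.comp_update]
  rfl

lemma PermFactor.entry_inv (h : PermFactor u x c a) {p q : Fin n} (hqp : q < p) :
    flagMinor p.2.le (Function.update (initialSeq u p.2.le) ⟨q, hqp⟩ (u⁻¹ p)) x
      = flagMinor p.2.le (initialSeq u p.2.le) x * (- a⁻¹ q p) := by
  rw [h.flagMinor_initialSeq, ← flagMinor_update_castLE h.upper hqp, ← h.flagMinor_comp,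
    Function.comp_update]
  rfl

/-! ### Signs of the entries -/

/-- The ratio `t` of two flag minors has the product of the two sorting signs as its sign, and the
displayed product computes it. -/
lemma FlagNonneg.ratio_nonneg (hx : FlagNonneg x) {p : ℕ} {hp : p ≤ n} {s : Fin p → Fin n}
    (hs : flagMinor hp s x ≠ 0) {b : Fin p} {k : Fin n} {t : ℝ}
    (ht : flagMinor hp (Function.update s b k) x = flagMinor hp s x * t) :
    0 ≤ t * ∏ d ∈ Finset.univ.erase b,
      (((s b : ℕ) : ℝ) - (s d : ℕ)) * (((k : ℕ) : ℝ) - (s d : ℕ)) := by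
  rcases eq_or_ne t 0 with rfl | ht0
  · rw [zero_mul]
  have hs' : flagMinor hp (Function.update s b k) x ≠ 0 := ht ▸ mul_ne_zero hs ht0
  have h1 := vdm_update_mul_vdm_nonneg s b k
  have h2 := hx.nonneg p hp s
  have h3 := hx.nonneg p hp (Function.update s b k)
  have hv := vdm_ne_zero (injective_of_flagMinor_ne_zero hs)
  have hv' := vdm_ne_zero (injective_of_flagMinor_ne_zero hs')
  rw [ht] at h3
  generalize ∏ d ∈ Finset.univ.erase b,
      (((s b : ℕ) : ℝ) - (s d : ℕ)) * (((k : ℕ) : ℝ) - (s d : ℕ)) = P at *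
  generalize vdm (Function.update s b k) = V' at *
  generalize vdm s = V at *
  generalize flagMinor hp s x = F at *
  have h4 : 0 ≤ (V' * V * F) ^ 2 * (t * P) := by
    have := mul_nonneg (mul_nonneg h1 h2) h3
    calc 0 ≤ V' * V * P * (V * F) * (V' * (F * t)) := this
      _ = _ := by ring
  exact nonneg_of_mul_nonneg_right h4 (by positivity)

/-- The value `u⁻¹(b)` as a real number. -/
def invVal (u : Equiv.Perm (Fin n)) (b : Fin n) : ℝ := ((u⁻¹ b : Fin n) : ℕ)

lemma PermFactor.entry_sign (h : PermFactor u x c a) (p r : Fin n) :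
    0 ≤ a p r * ∏ b ∈ Finset.Iio p,
      (invVal u p - invVal u b) * (invVal u r - invVal u b) := by
  have h1 := h.flag.ratio_nonneg (h.flagMinor_initialSeq_ne_zero _) (h.entry p r)
  convert h1 using 2
  symm
  refine Finset.prod_bij (fun d _ => Fin.castLE (Nat.succ_le_of_lt p.2) d) ?_ ?_ ?_ ?_
  · intro d hd
    rw [Finset.mem_Iio, Fin.lt_def, Fin.val_castLE]
    exact Fin.val_lt_last (Finset.ne_of_mem_erase hd)
  · intro d _ e _ hde
    exact Fin.castLE_injective _ hde
  · intro b hb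
    refine ⟨⟨b, Nat.lt_succ_of_lt (Fin.lt_def.1 (Finset.mem_Iio.1 hb))⟩, ?_, rfl⟩
    refine Finset.mem_erase.2 ⟨fun e => ?_, Finset.mem_univ _⟩
    have := congrArg Fin.val e
    exact (Finset.mem_Iio.1 hb).ne (Fin.ext this)
  · intro d _
    rfl

lemma PermFactor.entry_inv_sign (h : PermFactor u x c a) {p q : Fin n} (hqp : q < p) :
    0 ≤ - a⁻¹ q p * ∏ b ∈ (Finset.Iio p).erase q,
      (invVal u q - invVal u b) * (invVal u p - invVal u b) := by
  have h1 := h.flag.ratio_nonneg (h.flagMinor_initialSeq_ne_zero _) (h.entry_inv hqp)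
  convert h1 using 2
  symm
  refine Finset.prod_bij (fun d _ => Fin.castLE p.2.le d) ?_ ?_ ?_ ?_
  · intro d hd
    refine Finset.mem_erase.2 ⟨fun e => (Finset.ne_of_mem_erase hd) ?_, Finset.mem_Iio.2 d.2⟩
    have := congrArg Fin.val e
    exact Fin.ext this
  · intro d _ e _ hde
    exact Fin.castLE_injective _ hde
  · intro b hb
    obtain ⟨hb1, hb2⟩ := Finset.mem_erase.1 hb
    refine ⟨⟨b, Fin.lt_def.1 (Finset.mem_Iio.1 hb2)⟩, ?_, rfl⟩
    refine Finset.mem_erase.2 ⟨fun e => hb1 (Fin.ext ?_), Finset.mem_univ _⟩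
    exact congrArg (fun d : Fin p => d.val) e
  · intro d _
    rfl

lemma invVal_injective (u : Equiv.Perm (Fin n)) : Function.Injective (invVal u) := by
  intro b d h
  have : ((u⁻¹ b : Fin n) : ℕ) = (u⁻¹ d : Fin n) := by
    simpa [invVal] using h
  exact u⁻¹.injective (Fin.ext this)

/-- No integer lies strictly between two consecutive ones, so a third value is on the same side of
both. -/
lemma invVal_sub_mul_sub_pos {q r b : Fin n} (hqr : invVal u r = invVal u q + 1) (hq : b ≠ q)
    (hr : b ≠ r) : 0 < (invVal u q - invVal u b) * (invVal u r - invVal u b) := by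
  have h1 : ((u⁻¹ r : Fin n) : ℕ) = (u⁻¹ q : Fin n) + 1 := by
    have := hqr
    unfold invVal at this
    exact_mod_cast this
  have h2 : ((u⁻¹ b : Fin n) : ℕ) ≠ (u⁻¹ q : Fin n) :=
    fun e => hq (u⁻¹.injective (Fin.ext e))
  have h3 : ((u⁻¹ b : Fin n) : ℕ) ≠ (u⁻¹ r : Fin n) :=
    fun e => hr (u⁻¹.injective (Fin.ext e))
  unfold invVal
  rcases lt_or_gt_of_ne h2 with h | h
  · refine mul_pos (sub_pos.2 ?_) (sub_pos.2 ?_) <;> norm_cast; omega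
  · refine mul_pos_of_neg_of_neg (sub_neg.2 ?_) (sub_neg.2 ?_) <;> norm_cast; omega

lemma invVal_add_half_sub_ne_zero (q p : Fin n) : invVal u q + 1 / 2 - invVal u p ≠ 0 := by
  intro h
  have h1 : 2 * invVal u q + 1 = 2 * invVal u p := by linarith
  unfold invVal at h1
  norm_cast at h1
  omega

/-- In the sign products for `a⁻¹ q p` and `a p r`, indices other than `q` and `r` contribute
matching signs because `u⁻¹ q` and `u⁻¹ r` are adjacent. The shift by `1/2` gives the boundary cases
`p = q` and `p = r` weights of opposite sign. -/
lemma PermFactor.term_nonneg (h : PermFactor u x c a) {q r : Fin n}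
    (hqr : invVal u r = invVal u q + 1) (p : Fin n) :
    0 ≤ a⁻¹ q p * a p r * (invVal u q + 1 / 2 - invVal u p) := by
  have hi := Function.injective_id (α := Fin n)
  have hinv := unitri.inv hi h.upper
  have hne : q ≠ r := by
    rintro rfl
    linarith
  rcases lt_trichotomy p q with hpq | rfl | hqp
  · rw [hinv.1 hpq, zero_mul, zero_mul]
  · rcases lt_or_gt_of_ne hne with hpr | hpr
    · have h1 := h.entry_sign p r
      have h2 : 0 < ∏ b ∈ Finset.Iio p,
          (invVal u p - invVal u b) * (invVal u r - invVal u b) :=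
        Finset.prod_pos fun b hb => invVal_sub_mul_sub_pos hqr (Finset.mem_Iio.1 hb).ne
          ((Finset.mem_Iio.1 hb).trans hpr).ne
      have h3 := nonneg_of_mul_nonneg_left h1 h2
      rw [hinv.2, one_mul]
      exact mul_nonneg h3 (by linarith)
    · rw [h.upper.1 _ _ hpr, mul_zero, zero_mul]
  · rcases lt_trichotomy p r with hpr | rfl | hrp
    · have h1 := h.entry_sign p r
      have h2 := h.entry_inv_sign hqp
      rw [← Finset.mul_prod_erase _ _ (Finset.mem_Iio.2 hqp)] at h1
      have h3 : 0 < ∏ b ∈ (Finset.Iio p).erase q,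
          ((invVal u q - invVal u b) * (invVal u p - invVal u b)) *
          ((invVal u p - invVal u b) * (invVal u r - invVal u b)) := by
        refine Finset.prod_pos fun b hb => ?_
        obtain ⟨hb1, hb2⟩ := Finset.mem_erase.1 hb
        have hb2 := Finset.mem_Iio.1 hb2
        have h4 := invVal_sub_mul_sub_pos hqr hb1 (hb2.trans hpr).ne
        have h5 : invVal u p - invVal u b ≠ 0 :=
          sub_ne_zero.2 fun e => hb2.ne' (invVal_injective u e)
        calc 0 < (invVal u p - invVal u b) ^ 2 *
              ((invVal u q - invVal u b) * (invVal u r - invVal u b)) := by positivity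
          _ = _ := by ring
      rw [Finset.prod_mul_distrib] at h3
      -- The one unmatched factor, `b = q` in the sign of `a p r`, is `invVal u p - invVal u q`; the
      -- minus sign in front of `a⁻¹` reverses it.
      have h4 : 0 ≤ a⁻¹ q p * a p r * (invVal u q - invVal u p) := by
        refine nonneg_of_mul_nonneg_left ?_ h3
        have := mul_nonneg h1 h2
        rw [hqr] at this ⊢
        calc _ ≤ _ := this
          _ = _ := by ring
      have h5 : 0 < (invVal u q - invVal u p) * (invVal u q + 1 / 2 - invVal u p) := by
        have h6 : ((u⁻¹ q : Fin n) : ℕ) ≠ (u⁻¹ p : Fin n) :=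
          fun e => hqp.ne (u⁻¹.injective (Fin.ext e))
        rcases lt_or_gt_of_ne h6 with h7 | h7
        · have : invVal u q + 1 ≤ invVal u p := by
            unfold invVal
            exact_mod_cast h7
          exact mul_pos_of_neg_of_neg (by linarith) (by linarith)
        · have : invVal u p + 1 ≤ invVal u q := by
            unfold invVal
            exact_mod_cast h7
          exact mul_pos (by linarith) (by linarith)
      have h8 := mul_nonneg h4 h5.le
      have h9 : invVal u q - invVal u p ≠ 0 := left_ne_zero_of_mul h5.ne'
      refine nonneg_of_mul_nonneg_left (b := (invVal u q - invVal u p) ^ 2) ?_ (by positivity)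
      calc _ ≤ _ := h8
        _ = _ := by ring
    · have h1 := h.entry_inv_sign hqp
      have h2 : 0 < ∏ b ∈ (Finset.Iio p).erase q,
          (invVal u q - invVal u b) * (invVal u p - invVal u b) := by
        refine Finset.prod_pos fun b hb => ?_
        obtain ⟨hb1, hb2⟩ := Finset.mem_erase.1 hb
        exact invVal_sub_mul_sub_pos hqr hb1 (Finset.mem_Iio.1 hb2).ne
      have h3 := nonneg_of_mul_nonneg_left h1 h2
      rw [h.upper.2, mul_one]
      exact mul_nonneg_of_nonpos_of_nonpos (by linarith) (by linarith)
    · rw [h.upper.1 _ _ hrp, mul_zero, zero_mul]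

/-- The `(q, r)` entry of `a⁻¹ D a`, where `D` has diagonal entries `-u⁻¹(p)`. -/
lemma PermFactor.sum_eq (h : PermFactor u x c a) {q r : Fin n} (hqr : q ≠ r) (e : ℝ) :
    ∑ p, a⁻¹ q p * (e - invVal u p) * a p r
      = ∑ p, a⁻¹ q p * a p r * (invVal u q + 1 / 2 - invVal u p) := by
  -- An off-diagonal entry of `a⁻¹ a` vanishes, so a constant may be added to the weights.
  have h0 : ∑ p, a⁻¹ q p * a p r = 0 := by
    rw [← Matrix.mul_apply, unitri.inv_mul_self Function.injective_id h.upper, one_apply_ne hqr]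
  have h1 : ∑ p, (e - invVal u q - 1 / 2) * (a⁻¹ q p * a p r) = 0 := by
    rw [← Finset.mul_sum, h0, mul_zero]
  rw [← sub_eq_zero, ← Finset.sum_sub_distrib, ← h1]
  exact Finset.sum_congr rfl fun p _ => by ring

/-- If `a` has a nonzero entry above the diagonal in the ordering of indices by `u⁻¹`, then one of
the terms computing the adjacent entries of `a⁻¹ D a` does not vanish. -/
lemma PermFactor.exists_term_ne_zero (h : PermFactor u x c a) {p r : Fin n}
    (hpr : u⁻¹ p < u⁻¹ r) (ha : a p r ≠ 0) :
    ∃ q r' : Fin n, invVal u r' = invVal u q + 1 ∧ a⁻¹ q p * a p r' ≠ 0 := by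
  classical
  have hi := Function.injective_id (α := Fin n)
  have huu : ∀ k, u⁻¹ (u k) = k := fun k => u.symm_apply_apply k
  have hlt : p < r := by
    rcases lt_trichotomy p r with h1 | rfl | h1
    · exact h1
    · exact absurd hpr (lt_irrefl _)
    · exact absurd (h.upper.1 _ _ h1) ha
  -- Take the least position `m` after `u⁻¹ p` with `u m > p`. By minimality `u (m - 1)` is at most
  -- `p`, so `q = u (m - 1)` and `r' = u m` surround `p`.
  have hex : ∃ m : ℕ, ∃ hm : m < n, u⁻¹ p < ⟨m, hm⟩ ∧ p < u ⟨m, hm⟩ :=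
    ⟨u⁻¹ r, (u⁻¹ r).2, hpr, by simpa using hlt⟩
  obtain ⟨hj, hj1, hj2⟩ := Nat.find_spec hex
  have hmin := fun m hm => Nat.find_min hex (m := m) hm
  have hjr : Nat.find hex ≤ (u⁻¹ r : Fin n) :=
    Nat.find_min' hex ⟨(u⁻¹ r).2, hpr, by simpa using hlt⟩
  set m := Nat.find hex
  have hm0 : ((u⁻¹ p : Fin n) : ℕ) < m := hj1
  have hm1 : m - 1 < n := by omega
  refine ⟨u ⟨m - 1, hm1⟩, u ⟨m, hj⟩, ?_, mul_ne_zero ?_ ?_⟩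
  · simp only [invVal, huu]
    have : m = m - 1 + 1 := by omega
    exact_mod_cast this
  · rcases eq_or_lt_of_le (show ((u⁻¹ p : Fin n) : ℕ) ≤ m - 1 by omega) with h1 | h1
    · have : u ⟨m - 1, hm1⟩ = p := by
        rw [← Equiv.Perm.eq_inv_iff_eq]
        exact Fin.ext h1.symm
      rw [this, (unitri.inv hi h.upper).2]
      exact one_ne_zero
    · have hqp : u ⟨m - 1, hm1⟩ < p := by
        refine lt_of_le_of_ne (not_lt.1 fun h2 => hmin (m - 1) (by omega) ⟨hm1, h1, h2⟩) ?_
        intro h2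
        rw [← h2, huu] at h1
        exact lt_irrefl _ h1
      intro h0
      have h2 := h.entry_inv hqp
      rw [h0, neg_zero, mul_zero] at h2
      -- Column `m - 1` is replaced by the smaller `u⁻¹ p`, a Gale-lowering of a nonvanishing minor.
      refine h.flag.down _ _ (initialSeq u p.2.le) _ ?_ (countGE_mono ?_)
        (h.flagMinor_initialSeq_ne_zero _) h2
      · have : Function.update (initialSeq u p.2.le) ⟨u ⟨m - 1, hm1⟩, hqp⟩ (u⁻¹ p)
            = ⇑u⁻¹ ∘ Function.update (Fin.castLE p.2.le) ⟨u ⟨m - 1, hm1⟩, hqp⟩ p := by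
          rw [Function.comp_update]
          rfl
        rw [this]
        refine (Equiv.injective _).comp ?_
        have hne : ∀ d : Fin p, Fin.castLE p.2.le d ≠ p := by
          intro d e
          have := congrArg Fin.val e
          exact d.2.ne this
        intro d e hde
        by_cases hd : d = ⟨u ⟨m - 1, hm1⟩, hqp⟩ <;> by_cases he : e = ⟨u ⟨m - 1, hm1⟩, hqp⟩
        · rw [hd, he]
        · rw [hd, Function.update_self, Function.update_of_ne he] at hde
          exact absurd hde.symm (hne e)
        · rw [he, Function.update_self, Function.update_of_ne hd] at hde
          exact absurd hde (hne d)
        · rw [Function.update_of_ne hd, Function.update_of_ne he] at hde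
          exact Fin.castLE_injective _ hde
      · intro d
        by_cases hd : d = ⟨u ⟨m - 1, hm1⟩, hqp⟩
        · subst hd
          rw [Function.update_self]
          have : initialSeq u p.2.le ⟨u ⟨m - 1, hm1⟩, hqp⟩ = ⟨m - 1, hm1⟩ := by
            simp [initialSeq]
          rw [this]
          exact h1.le
        · rw [Function.update_of_ne hd]
  · intro h0
    have h1 := h.entry p r
    have h2 := h.entry p (u ⟨m, hj⟩)
    rw [h0, mul_zero] at h2
    have h3 := mul_ne_zero (h.flagMinor_initialSeq_ne_zero (Nat.succ_le_of_lt p.2)) ha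
    rw [← h1] at h3
    -- Here column `u⁻¹ r` is lowered to `m`; minimality of `m` gives `m ≤ u⁻¹ r`.
    refine h.flag.down _ _ _ _ ?_ (countGE_mono ?_) h3 h2
    · have : Function.update (initialSeq u (Nat.succ_le_of_lt p.2)) (Fin.last p) (u⁻¹ (u ⟨m, hj⟩))
          = ⇑u⁻¹ ∘ Function.update (Fin.castLE (Nat.succ_le_of_lt p.2)) (Fin.last p)
            (u ⟨m, hj⟩) := by
        rw [Function.comp_update]
        rfl
      rw [this]
      refine (Equiv.injective _).comp ?_
      have hne : ∀ d : Fin (p + 1), Fin.castLE (Nat.succ_le_of_lt p.2) d ≠ u ⟨m, hj⟩ := by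
        intro d e
        have h4 := congrArg Fin.val e
        rw [Fin.val_castLE] at h4
        have h5 : (p : ℕ) < u ⟨m, hj⟩ := hj2
        have := d.2
        omega
      intro d e hde
      by_cases hd : d = Fin.last p <;> by_cases he : e = Fin.last p
      · rw [hd, he]
      · rw [hd, Function.update_self, Function.update_of_ne he] at hde
        exact absurd hde.symm (hne e)
      · rw [he, Function.update_self, Function.update_of_ne hd] at hde
        exact absurd hde (hne d)
      · rw [Function.update_of_ne hd, Function.update_of_ne he] at hde
        exact Fin.castLE_injective _ hde
    · intro d
      by_cases hd : d = Fin.last p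
      · subst hd
        rw [Function.update_self, Function.update_self, huu]
        exact hjr
      · rw [Function.update_of_ne hd, Function.update_of_ne hd]

/-- On the open cell of `u` itself, the factor `a` is lower triangular in the ordering of indices by
`u⁻¹`. -/
lemma PermFactor.entry_eq_zero_of_mem_cell (h : PermFactor u x c a) (hx : x ∈ bruhatCell u)
    {p r : Fin n} (hpr : u⁻¹ p < u⁻¹ r) : a p r = 0 := by
  by_contra ha
  have h3 := mul_ne_zero (h.flagMinor_initialSeq_ne_zero (Nat.succ_le_of_lt p.2)) ha
  rw [← h.entry p r] at h3
  -- At the threshold `u⁻¹ r` the replacement raises the count by one, above the bound valid on the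
  -- cell of `u`.
  have h4 := countGE_le_of_flagMinor_ne_zero _ hx h3 (u⁻¹ r : Fin n)
  have h5 := countGE_update (initialSeq u (Nat.succ_le_of_lt p.2)) (Fin.last p) (u⁻¹ r)
    (u⁻¹ r : Fin n)
  have h6 : ¬ ((u⁻¹ r : Fin n) : ℕ) ≤ (initialSeq u (Nat.succ_le_of_lt p.2) (Fin.last p) : ℕ) :=
    not_le.2 hpr
  rw [if_neg h6, if_pos le_rfl] at h5
  omega

end

section
variable {n : ℕ} {τ : ℝ}

/-! ### The torus action -/

lemma torus_eq_diagonal (τ : ℝ) : torus n τ =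
    diagonal fun i : Fin n => τ ^ (-((n : ℝ) - 1) / 2) * τ ^ (n - 1 - i.val) := by
  rw [torus, ← diagonal_smul]
  rfl

lemma torus_ne_zero (hτ : 0 < τ) (i : Fin n) :
    τ ^ (-((n : ℝ) - 1) / 2) * τ ^ (n - 1 - i.val) ≠ 0 :=
  mul_ne_zero (Real.rpow_pos_of_pos hτ _).ne' (pow_ne_zero _ hτ.ne')

lemma torus_inv (hτ : 0 < τ) : (torus n τ)⁻¹ =
    diagonal fun i : Fin n => (τ ^ (-((n : ℝ) - 1) / 2) * τ ^ (n - 1 - i.val))⁻¹ := by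
  refine inv_eq_right_inv ?_
  rw [torus_eq_diagonal, diagonal_mul_diagonal, ← diagonal_one]
  congr 1
  funext i
  exact mul_inv_cancel₀ (torus_ne_zero hτ i)

lemma torus_det_ne_zero (hτ : 0 < τ) : (torus n τ).det ≠ 0 := by
  rw [torus_eq_diagonal, det_diagonal]
  exact Finset.prod_ne_zero_iff.2 fun i _ => torus_ne_zero hτ i

lemma scale_apply (hτ : 0 < τ) (x : Mat n) (i j : Fin n) :
    scale τ x i j = τ ^ ((j : ℤ) - (i : ℤ)) * x i j := by
  rw [scale, torus_inv hτ, torus_eq_diagonal, mul_diagonal, diagonal_mul]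
  have h1 : τ ^ (-((n : ℝ) - 1) / 2) ≠ 0 := (Real.rpow_pos_of_pos hτ _).ne'
  have h2 : τ ^ ((j : ℤ) - (i : ℤ)) * τ ^ (n - 1 - j.val) = τ ^ (n - 1 - i.val) := by
    rw [← zpow_natCast, ← zpow_natCast, ← zpow_add₀ hτ.ne']
    congr 1
    have := i.2
    have := j.2
    omega
  have h3 : τ ^ (n - 1 - j.val) ≠ 0 := pow_ne_zero _ hτ.ne'
  rw [← h2]
  field_simp

lemma scale_mul (hτ : 0 < τ) (x y : Mat n) : scale τ (x * y) = scale τ x * scale τ y := by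
  have h := inv_mul_self_of_det (torus_det_ne_zero (n := n) hτ)
  calc scale τ (x * y) = torus n τ * x * 1 * y * (torus n τ)⁻¹ := by
        rw [scale, mul_one]; simp only [mul_assoc]
    _ = scale τ x * scale τ y := by rw [← h, scale, scale]; simp only [mul_assoc]

lemma scale_one_matrix (hτ : 0 < τ) : scale τ (1 : Mat n) = 1 := by
  rw [scale, mul_one, mul_inv_self_of_det (torus_det_ne_zero hτ)]

lemma scale_one (x : Mat n) : scale 1 x = x := by
  ext i j
  rw [scale_apply one_pos, _root_.one_zpow, one_mul]

lemma scale_mem_unitri {α : Type*} [LinearOrder α] {b : Fin n → α} (hτ : 0 < τ) {x : Mat n}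
    (hx : x ∈ unitri b) : scale τ x ∈ unitri b :=
  ⟨fun i j h => by rw [scale_apply hτ, hx.1 h, mul_zero],
    fun i => by rw [scale_apply hτ, hx.2, sub_self, zpow_zero, mul_one]⟩

lemma torus_mem_Bminus (hτ : 0 < τ) : torus n τ ∈ Bminus n := by
  rw [torus_eq_diagonal]
  refine ⟨fun i j h => diagonal_apply_ne _ h.ne, fun i => ?_⟩
  rw [diagonal_apply_eq]
  exact torus_ne_zero hτ i

lemma scale_mem_Y (hτ : 0 < τ) {x : Mat n} (hx : x ∈ Y n) : scale τ x ∈ Y n := by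
  refine Submonoid.closure_induction (motive := fun x _ => scale τ x ∈ Y n) ?_ ?_ ?_ hx
  · rintro _ ⟨i, h, t, ht, rfl⟩
    refine Submonoid.subset_closure ⟨i, h, τ * t, mul_nonneg hτ.le ht, ?_⟩
    ext k l
    rw [scale_apply hτ, transvection, transvection, Matrix.add_apply, Matrix.add_apply, mul_add]
    congr 1
    · by_cases hkl : k = l
      · subst hkl
        rw [sub_self, zpow_zero, one_mul]
      · rw [one_apply_ne hkl, mul_zero]
    · rw [single_apply, single_apply]
      split_ifs with hkl
      · obtain ⟨rfl, rfl⟩ := hkl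
        have : (((⟨i + 1, h⟩ : Fin n) : ℕ) : ℤ) - (i : ℕ) = 1 := by push_cast; ring
        rw [this, zpow_one]
      · rw [mul_zero]
  · rw [scale_one_matrix hτ]
    exact one_mem _
  · intro a c _ _ ha hc
    rw [scale_mul hτ]
    exact mul_mem ha hc

lemma scale_mem_bruhatCell (hτ : 0 < τ) {w : Equiv.Perm (Fin n)} {x : Mat n}
    (hx : x ∈ bruhatCell w) : scale τ x ∈ bruhatCell w := by
  obtain ⟨c, hc, d, hd, rfl⟩ := hx
  refine ⟨_, Bminus.mul (torus_mem_Bminus hτ) hc, _, Bminus.mul hd (Bminus.inv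
    (torus_mem_Bminus hτ)), ?_⟩
  rw [scale]
  simp only [mul_assoc]

lemma scale_mem_Ygeq (hτ : 0 < τ) {u : Equiv.Perm (Fin n)} {x : Mat n} (hx : x ∈ Ygeq u) :
    scale τ x ∈ Ygeq u := by
  obtain ⟨v, huv, hxY, hxv⟩ := hx
  exact ⟨v, huv, scale_mem_Y hτ hxY, scale_mem_bruhatCell hτ hxv⟩

/-- Moving `d(τ)⁻¹` across `u` only permutes its diagonal entries, so it is absorbed into `B₋`. -/
lemma exists_scale_perm_eq (hτ : 0 < τ) (u : Equiv.Perm (Fin n)) {c : Mat n} (hc : c ∈ Bminus n)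
    (g : Mat n) : ∃ c' ∈ Bminus n, scale τ (c * perm u * g) = c' * perm u * scale τ g := by
  have hd : perm u * (torus n τ)⁻¹ * perm u⁻¹ ∈ Bminus n := by
    rw [torus_inv hτ]
    refine ⟨fun i j h => ?_, fun i => ?_⟩
    · rw [mul_perm_apply, perm_mul_apply, diagonal_apply_ne]
      exact fun e => h.ne (u⁻¹.injective e)
    · rw [mul_perm_apply, perm_mul_apply, diagonal_apply_eq]
      exact inv_ne_zero (torus_ne_zero hτ _)
  refine ⟨_, Bminus.mul (Bminus.mul (torus_mem_Bminus hτ) hc) hd, ?_⟩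
  have h1 := inv_mul_self_of_det (torus_det_ne_zero (n := n) hτ)
  have h2 := perm_inv_mul_perm u
  calc scale τ (c * perm u * g) = torus n τ * c * perm u * 1 * g * (torus n τ)⁻¹ := by
        rw [scale, mul_one]; simp only [mul_assoc]
    _ = torus n τ * c * perm u * (torus n τ)⁻¹ * scale τ g := by
        rw [← h1, scale]; simp only [mul_assoc]
    _ = torus n τ * c * perm u * (torus n τ)⁻¹ * 1 * scale τ g := by rw [mul_one]
    _ = _ := by rw [← h2]; simp only [mul_assoc]

/-! ### The fibers of the projection -/

variable {u : Equiv.Perm (Fin n)}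

lemma exists_permFactor {x : Mat n} (hx : x ∈ Ygeq u) : ∃ c a, PermFactor u x c a := by
  obtain ⟨c, hc, a, ha, h⟩ := exists_Bminus_mul_N (y := x * perm u⁻¹) fun p hp => by
    have := flagMinor_mul_perm hp (Fin.castLE hp) x u⁻¹
    have h2 := flagMinor_ne_zero_of_mem_Ygeq hp hx
    rw [initialSeq, ← this] at h2
    exact h2
  obtain ⟨v, -, hxY, -⟩ := hx
  exact ⟨c, a, flagNonneg_of_mem_Y hxY, hc, ha, h⟩

/-- Coordinates on the fiber: `x_u = c u l` and `x = x_u z`, where `u l z u⁻¹ = a` is the unipotent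
factor of `x u⁻¹`. -/
structure FiberFactor (u : Equiv.Perm (Fin n)) (xu x c a l z : Mat n) : Prop
    extends PermFactor u x c a where
  left_mem : l ∈ unitri u ∩ Nminus n
  right_mem : z ∈ unitri u ∩ N n
  conj : perm u⁻¹ * a * perm u = l * z
  base : xu = c * perm u * l
  base_mem : xu ∈ N n
  eq_mul : x = xu * z

/-- The brackets of `π_u` are, from the inside, `a`, then `l`, then `[u l]₊`; the last is `x z⁻¹`
because `u l = c⁻¹ (x z⁻¹)`. -/
lemma PermFactor.exists_fiberFactor {x c a : Mat n} (h : PermFactor u x c a) (hx : x ∈ N n) :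
    ∃ l z, FiberFactor u (piProj u x) x c a l z := by
  have hi := Function.injective_id (α := Fin n)
  obtain ⟨l, hl, z, hz, hlz⟩ := unitri.exists_lower_mul_upper u.injective
    (conj_inv_mem_unitri (u := u) h.upper)
  have hxe : x = c * perm u * (l * z) := by
    calc x = x * (perm u⁻¹ * perm u) := by rw [perm_inv_mul_perm, mul_one]
      _ = c * 1 * a * perm u := by rw [← mul_assoc, h.eq, mul_one]
      _ = c * perm u * (perm u⁻¹ * a * perm u) := by
        rw [← perm_mul_perm_inv u]; simp only [mul_assoc]
      _ = _ := by rw [hlz]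
  have hxz : x * z⁻¹ = c * perm u * l := by
    rw [hxe, mul_assoc, mul_assoc l, unitri.mul_inv_self hi hz.2, mul_one]
  have hxzN : x * z⁻¹ ∈ N n := unitri.mul hi hx (unitri.inv hi hz.2)
  have hpi : piProj u x = x * z⁻¹ := by
    rw [piProj, h.eq, gaussPlus_mul h.lower h.upper, hlz, gaussMinus_mul hl.2 hz.2]
    have : perm u * l = c⁻¹ * (x * z⁻¹) := by
      rw [hxz, mul_assoc, ← mul_assoc, inv_mul_self_of_det (Bminus.det_ne_zero h.lower), one_mul]
    rw [this, gaussPlus_mul (Bminus.inv h.lower) hxzN]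
  refine ⟨l, z, ⟨h, hl, hz, hlz, by rw [hpi, hxz], hpi ▸ hxzN, ?_⟩⟩
  rw [hpi, mul_assoc, unitri.inv_mul_self hi hz.2, mul_one]

lemma exists_fiberFactor {xu x : Mat n} (hx : x ∈ fiber u xu) :
    ∃ c a l z, FiberFactor u xu x c a l z := by
  obtain ⟨hx1, rfl⟩ := hx
  obtain ⟨c, a, h⟩ := exists_permFactor hx1
  obtain ⟨v, -, hxY, -⟩ := hx1
  obtain ⟨l, z, h'⟩ := h.exists_fiberFactor (mem_N_of_mem_Y hxY)
  exact ⟨c, a, l, z, h'⟩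

variable {xu x c a l z : Mat n}

lemma FiberFactor.mul_apply (h : FiberFactor u xu x c a l z) (i j : Fin n) :
    (l * z) i j = a (u i) (u j) := by
  rw [← h.conj, mul_perm_apply, perm_mul_apply, inv_inv]

lemma FiberFactor.mem_unitri (h : FiberFactor u xu x c a l z) : l * z ∈ unitri u :=
  unitri.mul u.injective h.left_mem.1 h.right_mem.1

lemma FiberFactor.inv_apply (h : FiberFactor u xu x c a l z) (i j : Fin n) :
    (l * z)⁻¹ i j = a⁻¹ (u i) (u j) := by
  have : (l * z)⁻¹ = perm u⁻¹ * a⁻¹ * perm u := by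
    refine inv_eq_right_inv ?_
    rw [← h.conj]
    calc perm u⁻¹ * a * perm u * (perm u⁻¹ * a⁻¹ * perm u)
        = perm u⁻¹ * (a * (perm u * perm u⁻¹) * a⁻¹) * perm u := by simp only [mul_assoc]
      _ = 1 := by
        rw [perm_mul_perm_inv, mul_one, unitri.mul_inv_self Function.injective_id h.upper, mul_one,
          perm_inv_mul_perm]
  rw [this, mul_perm_apply, perm_mul_apply, inv_inv]

lemma FiberFactor.right_eq_one (h : FiberFactor u xu x c a l z)
    (h0 : ∀ p r : Fin n, u⁻¹ p < u⁻¹ r → a p r = 0) : z = 1 := by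
  have hi := Function.injective_id (α := Fin n)
  have hg : l * z ∈ Nminus n := by
    refine ⟨fun i j hij => ?_, h.mem_unitri.2⟩
    rw [h.mul_apply]
    refine h0 _ _ ?_
    simpa using hij
  have := Bminus_mul_N_unique (Nminus_subset_Bminus hg) (Nminus_subset_Bminus h.left_mem.2)
    (unitri.one (b := id)) h.right_mem.2 (mul_one _)
  exact this.2.symm

lemma FiberFactor.eq_of_right_eq_one (h : FiberFactor u xu x c a l z) (hz : z = 1) : x = xu := by
  rw [h.eq_mul, hz, mul_one]

lemma base_mem_fiber (hxu : xu ∈ Ycell u) : xu ∈ fiber u xu := by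
  have h1 : xu ∈ Ygeq u := ⟨u, subset_closure, hxu⟩
  refine ⟨h1, ?_⟩
  obtain ⟨c, a, h⟩ := exists_permFactor h1
  obtain ⟨l, z, h'⟩ := h.exists_fiberFactor (mem_N_of_mem_Y hxu.1)
  exact (h'.eq_of_right_eq_one (h'.right_eq_one fun p r hpr =>
    h.entry_eq_zero_of_mem_cell hxu.2 hpr)).symm

/-! ### The shift and the second projection -/

/-- Here `X m = c' u l z' = (c' c⁻¹) (x_u z')`, already factored in `B₋ N`. -/
lemma isShift_of_factor {X c' G m z' : Mat n} (hc : c ∈ Bminus n)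
    (hxu : xu ∈ N n) (hbase : xu = c * perm u * l) (hc' : c' ∈ Bminus n)
    (hX : X = c' * perm u * G) (hm : m ∈ unitri u ∩ Nminus n) (hz' : z' ∈ unitri u ∩ N n)
    (hG : G = l * z' * m⁻¹) : IsShift u xu X m ∧ gaussPlus (X * m) = xu * z' := by
  have hi := Function.injective_id (α := Fin n)
  have hXm : X * m = (c' * c⁻¹) * (xu * z') := by
    calc X * m = c' * 1 * perm u * l * z' * (m⁻¹ * m) := by
          rw [hX, hG, mul_one]; simp only [mul_assoc]
      _ = _ := by
        rw [unitri.inv_mul_self toDual_inj hm.2, mul_one,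
          ← inv_mul_self_of_det (Bminus.det_ne_zero hc), hbase]
        simp only [mul_assoc]
  have hcc := Bminus.mul hc' (Bminus.inv hc)
  have hxz : xu * z' ∈ N n := unitri.mul hi hxu hz'.2
  have hgp : gaussPlus (X * m) = xu * z' := by rw [hXm, gaussPlus_mul hcc hxz]
  refine ⟨⟨by rwa [NminusOf_eq], ?_, z', by rwa [NOf_eq], hgp⟩, hgp⟩
  rw [hXm]
  exact mul_mem_G0 hcc hxz

/-- Conjugating by `u` and using uniqueness in `B₋ N` gives `G m' = l z''`. Then `m⁻¹ m' = z'⁻¹ z''`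
is both lower and upper unipotent. -/
lemma isShift_unique {X c' G m z' m' : Mat n} (hc : c ∈ Bminus n) (hl : l ∈ unitri u ∩ Nminus n)
    (hbase : xu = c * perm u * l) (hc' : c' ∈ Bminus n)
    (hX : X = c' * perm u * G) (hm : m ∈ unitri u ∩ Nminus n) (hz' : z' ∈ unitri u ∩ N n)
    (hG : G = l * z' * m⁻¹) (h : IsShift u xu X m') : m' = m := by
  have hi := Function.injective_id (α := Fin n)
  have hu := u.injective
  obtain ⟨hm', hG0, z'', hz'', hgp⟩ := h
  rw [NminusOf_eq] at hm'
  rw [NOf_eq] at hz''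
  obtain ⟨e, he, -, hXm⟩ := exists_eq_mul_gaussPlus hG0
  rw [hgp] at hXm
  have hGm : G * m' ∈ unitri u := by
    rw [hG]
    exact unitri.mul hu (unitri.mul hu (unitri.mul hu hl.1 hz'.1) (unitri.inv hu hm.1)) hm'.1
  have hlz : l * z'' ∈ unitri u := unitri.mul hu hl.1 hz''.1
  have h1 : c' * (perm u * (G * m') * perm u⁻¹) = (e * c) * (perm u * (l * z'') * perm u⁻¹) := by
    calc c' * (perm u * (G * m') * perm u⁻¹) = X * m' * perm u⁻¹ := by
          rw [hX]; simp only [mul_assoc]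
      _ = _ := by rw [hXm, hbase]; simp only [mul_assoc]
  have h2 := (Bminus_mul_N_unique hc' (Bminus.mul he hc) (conj_mem_N hGm) (conj_mem_N hlz) h1).2
  have h3 : G * m' = l * z'' := by
    have := congrArg (fun A => perm u⁻¹ * A * perm u) h2
    simp only [mul_assoc, perm_inv_mul_perm, mul_one] at this
    simpa only [← mul_assoc, perm_inv_mul_perm, one_mul] using this
  have h4 : m⁻¹ * m' = z'⁻¹ * z'' := by
    rw [hG] at h3
    calc m⁻¹ * m' = z'⁻¹ * (l⁻¹ * l) * z' * m⁻¹ * m' := by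
          rw [unitri.inv_mul_self hu hl.1, mul_one, unitri.inv_mul_self hu hz'.1, one_mul]
      _ = z'⁻¹ * (l⁻¹ * (l * z' * m⁻¹ * m')) := by simp only [mul_assoc]
      _ = z'⁻¹ * (l⁻¹ * l * z'') := by rw [h3]; simp only [mul_assoc]
      _ = _ := by rw [unitri.inv_mul_self hu hl.1, one_mul]
  have h5 : m⁻¹ * m' = 1 := eq_one_of_mem_Bminus_of_mem_N
    (Nminus_subset_Bminus (unitri.mul toDual_inj (unitri.inv toDual_inj hm.2) hm'.2))
    (h4 ▸ unitri.mul hi (unitri.inv hi hz'.2) hz''.2)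
  calc m' = m * (m⁻¹ * m') := by rw [← mul_assoc, unitri.mul_inv_self hu hm.1, one_mul]
    _ = m := by rw [h5, mul_one]

/-- The element `m` and the value of `ρ` at a rescaled point of the fiber, through the factorization
`l⁻¹ g(τ) = w⁻¹ m⁻¹`. -/
lemma FiberFactor.exists_shift (h : FiberFactor u xu x c a l z) (hτ : 0 < τ) :
    ∃ m ∈ unitri u ∩ Nminus n, ∃ w ∈ unitri u ∩ N n,
      scale τ (l * z)⁻¹ * l = m * w ∧ IsShift u xu (scale τ x) m ∧
      (∀ m', IsShift u xu (scale τ x) m' → m' = m) ∧ rho u xu (scale τ x) = xu * w⁻¹ := by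
  have hi := Function.injective_id (α := Fin n)
  have hu := u.injective
  have hg := h.mem_unitri
  -- The required factorization is upper times lower; inverting it gives the lower-times-upper order
  -- available in `unitri u`.
  obtain ⟨m, hm, w, hw, hmw⟩ := unitri.exists_lower_mul_upper hu
    (unitri.mul hu (scale_mem_unitri hτ (unitri.inv hu hg)) h.left_mem.1)
  obtain ⟨c', hc', hX⟩ := exists_scale_perm_eq hτ u h.lower (l * z)
  have hx : c * perm u * (l * z) = x := by
    rw [h.eq_mul, h.base]; simp only [mul_assoc]
  rw [hx] at hX
  have hw' : w⁻¹ ∈ unitri u ∩ N n := ⟨unitri.inv hu hw.1, unitri.inv hi hw.2⟩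
  have hG : scale τ (l * z) = l * w⁻¹ * m⁻¹ := by
    have h1 : scale τ (l * z) * scale τ (l * z)⁻¹ = 1 := by
      rw [← scale_mul hτ, unitri.mul_inv_self hu hg, scale_one_matrix hτ]
    calc scale τ (l * z) = scale τ (l * z) * (m * (w * w⁻¹) * m⁻¹) := by
          rw [unitri.mul_inv_self hu hw.1, mul_one, unitri.mul_inv_self hu hm.1, mul_one]
      _ = scale τ (l * z) * ((m * w) * (w⁻¹ * m⁻¹)) := by simp only [mul_assoc]
      _ = (scale τ (l * z) * scale τ (l * z)⁻¹) * l * (w⁻¹ * m⁻¹) := by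
          rw [← hmw]; simp only [mul_assoc]
      _ = _ := by rw [h1, one_mul]; simp only [mul_assoc]
  obtain ⟨hs1, hs2⟩ := isShift_of_factor h.lower h.base_mem h.base hc' hX hm hw' hG
  have huniq := fun m' h' =>
    isShift_unique (m' := m') h.lower h.left_mem h.base hc' hX hm hw' hG h'
  refine ⟨m, hm, w, hw, hmw, hs1, huniq, ?_⟩
  have hex : ∃ m, IsShift u xu (scale τ x) m := ⟨m, hs1⟩
  rw [rho, dif_pos hex, huniq _ hex.choose_spec, hs2]

/-! ### Differentiation -/

lemma differentiableAt_det {m : Type*} [Fintype m] [DecidableEq m] {A : ℝ → Matrix m m ℝ} {t : ℝ}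
    (h : ∀ i j, DifferentiableAt ℝ (fun s => A s i j) t) :
    DifferentiableAt ℝ (fun s => (A s).det) t := by
  simp only [det_apply']
  refine DifferentiableAt.fun_sum fun σ _ => DifferentiableAt.const_mul ?_ _
  exact DifferentiableAt.fun_finsetProd fun i _ => h _ _

lemma differentiableAt_adjugate {A : ℝ → Mat n} {t : ℝ}
    (h : ∀ i j, DifferentiableAt ℝ (fun s => A s i j) t) (i j : Fin n) :
    DifferentiableAt ℝ (fun s => (A s).adjugate i j) t := by
  simp only [adjugate_apply]
  refine differentiableAt_det fun k l => ?_
  by_cases hk : k = j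
  · subst hk
    simp only [updateRow_self]
    exact differentiableAt_const _
  · simp only [updateRow_ne hk]
    exact h k l

lemma hasDerivAt_matrix_mul {A C : ℝ → Mat n} {A' C' : Mat n} {t : ℝ}
    (hA : ∀ i j, HasDerivAt (fun s => A s i j) (A' i j) t)
    (hC : ∀ i j, HasDerivAt (fun s => C s i j) (C' i j) t) (i j : Fin n) :
    HasDerivAt (fun s => (A s * C s) i j) ((A' * C t + A t * C') i j) t := by
  have : (A' * C t + A t * C') i j = ∑ k, (A' i k * C t k j + A t i k * C' k j) := by
    rw [Matrix.add_apply, Matrix.mul_apply, Matrix.mul_apply, Finset.sum_add_distrib]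
  rw [this]
  simp only [Matrix.mul_apply]
  exact HasDerivAt.fun_sum fun k _ => (hA i k).mul (hC k j)

/-- The diagonal matrix with entries `0, -1, -2, …`, which generates the torus action. -/
def gradingMatrix (n : ℕ) : Mat n := diagonal fun i : Fin n => -((i : ℕ) : ℝ)

lemma hasDerivAt_scale (g : Mat n) (i j : Fin n) :
    HasDerivAt (fun τ => scale τ g i j) ((gradingMatrix n * g - g * gradingMatrix n) i j) 1 := by
  have h1 : HasDerivAt (fun τ : ℝ => τ ^ ((j : ℤ) - (i : ℤ)) * g i j)
      ((((j : ℤ) - (i : ℤ) : ℤ) : ℝ) * (1 : ℝ) ^ ((j : ℤ) - (i : ℤ) - 1) * g i j) 1 :=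
    (hasDerivAt_zpow _ _ (Or.inl one_ne_zero)).mul_const _
  have h2 : (gradingMatrix n * g - g * gradingMatrix n) i j
      = (((j : ℤ) - (i : ℤ) : ℤ) : ℝ) * (1 : ℝ) ^ ((j : ℤ) - (i : ℤ) - 1) * g i j := by
    rw [Matrix.sub_apply, gradingMatrix, diagonal_mul, mul_diagonal, _root_.one_zpow]
    push_cast
    ring
  rw [h2]
  refine h1.congr_of_eventuallyEq ?_
  filter_upwards [lt_mem_nhds (zero_lt_one (α := ℝ))] with τ hτ
  exact scale_apply hτ g i j

/-- The strictly upper triangular part of a matrix. -/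
def strictUpper (A : Mat n) : Mat n := of fun i j => if i < j then A i j else 0

lemma FiberFactor.hasDerivAt_rho (h : FiberFactor u xu x c a l z) :
    HasDerivAt (fun τ => rho u xu (scale τ x))
      (x * strictUpper ((l * z)⁻¹ * gradingMatrix n * (l * z))) 1 := by
  have hi := Function.injective_id (α := Fin n)
  have hu := u.injective
  have hg := h.mem_unitri
  have hpos : ∀ᶠ τ : ℝ in nhds 1, 0 < τ := lt_mem_nhds (zero_lt_one (α := ℝ))
  set g := l * z with hgdef
  -- The upper factor is expressed through flag minors, and its inverse through the adjugate since
  -- its determinant is `1`; differentiability at `τ = 1` is then visible.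
  let W : ℝ → Mat n := fun τ => of fun p r => flagMinor (Nat.succ_le_of_lt p.2)
    (Function.update (Fin.castLE (Nat.succ_le_of_lt p.2)) (Fin.last p) r) (scale τ g⁻¹ * l)
  let Z : ℝ → Mat n := fun τ => (W τ).adjugate
  let C : ℝ → Mat n := fun τ => W τ * (l⁻¹ * scale τ g)
  have key : ∀ τ, 0 < τ → Z τ ∈ N n ∧ C τ ∈ Nminus n ∧ Z τ * C τ = l⁻¹ * scale τ g ∧
      rho u xu (scale τ x) = xu * Z τ := by
    intro τ hτ
    obtain ⟨m, hm, w, hw, hmw, -, -, hrho⟩ := h.exists_shift hτ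
    rw [← hgdef] at hmw
    have hW : W τ = w := by
      ext p r
      simp only [W, of_apply]
      rw [hmw, flagMinor_lower_mul _ _ hm.2.1, flagMinor_update_last hw.2]
      have : (leading (p + 1) (Nat.succ_le_of_lt p.2) m).det = 1 := by
        rw [det_of_blockTriangular_injective (b := fun i : Fin (p + 1) => OrderDual.toDual i)
          (OrderDual.toDual.injective) (by intro i j h; exact hm.2.1 _ _ h)]
        exact Finset.prod_eq_one fun i _ => hm.2.2 _
      rw [this, one_mul]
    have hdet : w.det = 1 := by
      rw [det_of_blockTriangular_injective hi hw.2.1]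
      exact Finset.prod_eq_one fun i _ => hw.2.2 _
    have hZ : Z τ = w⁻¹ := by
      simp only [Z]
      rw [hW, inv_def, hdet, Ring.inverse_one, one_smul]
    have h1 : scale τ g⁻¹ * scale τ g = 1 := by
      rw [← scale_mul hτ, unitri.inv_mul_self hu hg, scale_one_matrix hτ]
    have hC : C τ = m⁻¹ := by
      simp only [C]
      rw [hW]
      calc w * (l⁻¹ * scale τ g) = m⁻¹ * (m * w) * (l⁻¹ * scale τ g) := by
            rw [← mul_assoc m⁻¹, unitri.inv_mul_self hu hm.1, one_mul]
        _ = m⁻¹ * (scale τ g⁻¹ * (l * l⁻¹) * scale τ g) := by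
            rw [← hmw]; simp only [mul_assoc]
        _ = m⁻¹ := by
            rw [unitri.mul_inv_self hu h.left_mem.1, mul_one, h1, mul_one]
    refine ⟨?_, ?_, ?_, ?_⟩
    · rw [hZ]
      exact unitri.inv hi hw.2
    · rw [hC]
      exact unitri.inv toDual_inj hm.2
    · simp only [C]
      rw [hZ, hW, ← mul_assoc, unitri.inv_mul_self hi hw.2, one_mul]
    · rw [hrho, hZ]
  have hconst : ∀ A : Mat n, ∀ i j, HasDerivAt (fun _ : ℝ => A i j) ((0 : Mat n) i j) 1 :=
    fun A i j => hasDerivAt_const _ _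
  have hdW : ∀ p r, DifferentiableAt ℝ (fun τ => W τ p r) 1 := by
    intro p r
    refine differentiableAt_det fun i j => ?_
    exact (hasDerivAt_matrix_mul (hasDerivAt_scale g⁻¹) (hconst l) _ _).differentiableAt
  have hdZ : ∀ p r, DifferentiableAt ℝ (fun τ => Z τ p r) 1 := differentiableAt_adjugate hdW
  have hlg := hasDerivAt_matrix_mul (hconst l⁻¹) (hasDerivAt_scale g)
  set Z' : Mat n := of fun i j => deriv (fun τ => Z τ i j) 1 with hZ'
  have hZd : ∀ i j, HasDerivAt (fun τ => Z τ i j) (Z' i j) 1 := fun i j => (hdZ i j).hasDerivAt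
  have hCd0 := hasDerivAt_matrix_mul (A := W) (A' := of fun i j => deriv (fun τ => W τ i j) 1)
    (fun i j => (hdW i j).hasDerivAt) hlg
  obtain ⟨C', hCd⟩ : ∃ C' : Mat n, ∀ i j, HasDerivAt (fun τ => C τ i j) (C' i j) 1 := ⟨_, hCd0⟩
  -- Near `τ = 1` the entries on and below the diagonal are constant, so `Z'` is strictly upper
  -- triangular.
  have hZup : ∀ i j, j ≤ i → Z' i j = 0 := by
    intro i j hij
    refine (hZd i j).unique ?_
    have : (fun τ => Z τ i j) =ᶠ[nhds 1] fun _ => if j < i then 0 else 1 := by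
      filter_upwards [hpos] with τ hτ
      rcases hij.lt_or_eq with hlt | rfl
      · rw [if_pos hlt, (key τ hτ).1.1 _ _ hlt]
      · rw [if_neg (lt_irrefl _), (key τ hτ).1.2]
    exact (hasDerivAt_const _ _).congr_of_eventuallyEq this
  have hClow : ∀ i j, i < j → C' i j = 0 := by
    intro i j hij
    refine (hCd i j).unique ?_
    have : (fun τ => C τ i j) =ᶠ[nhds 1] fun _ => 0 := by
      filter_upwards [hpos] with τ hτ
      exact (key τ hτ).2.1.1 _ _ hij
    exact (hasDerivAt_const _ _).congr_of_eventuallyEq this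
  obtain ⟨hZ1N, hC1N, hZC1, -⟩ := key 1 one_pos
  have hZC1' : Z 1 = z ∧ C 1 = 1 := by
    have e1 : l⁻¹ * scale 1 g = z := by
      rw [scale_one, hgdef, ← mul_assoc, unitri.inv_mul_self hu h.left_mem.1, one_mul]
    rw [e1] at hZC1
    have e2 : (Z 1)⁻¹ * z = C 1 := by
      rw [← hZC1, ← mul_assoc, unitri.inv_mul_self hi hZ1N, one_mul]
    have e3 : C 1 = 1 := eq_one_of_mem_Bminus_of_mem_N (Nminus_subset_Bminus hC1N)
      (e2 ▸ unitri.mul hi (unitri.inv hi hZ1N) h.right_mem.2)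
    exact ⟨by rw [← hZC1, e3, mul_one], e3⟩
  have hprod : Z' + z * C' = l⁻¹ * (gradingMatrix n * g - g * gradingMatrix n) := by
    ext i j
    have e1 := hasDerivAt_matrix_mul hZd hCd i j
    rw [hZC1'.1, hZC1'.2, mul_one] at e1
    have e2 := hlg i j
    rw [zero_mul, zero_add] at e2
    refine e1.unique (e2.congr_of_eventuallyEq ?_)
    filter_upwards [hpos] with τ hτ
    rw [(key τ hτ).2.2.1]
  -- Left multiplication by `z⁻¹` turns the product rule into `z⁻¹ Z' + C' = g⁻¹ D g - D`. Since
  -- `C'` is lower triangular and `D` diagonal, strictly upper parts isolate `z⁻¹ Z'`.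
  have hS : z⁻¹ * Z' = strictUpper (g⁻¹ * gradingMatrix n * g) := by
    have hz := unitri.inv_mul_self hi h.right_mem.2
    have hginv : z⁻¹ * l⁻¹ = g⁻¹ := by rw [hgdef, Matrix.mul_inv_rev]
    have e1 : z⁻¹ * Z' + C' = g⁻¹ * gradingMatrix n * g - gradingMatrix n := by
      have := congrArg (fun A => z⁻¹ * A) hprod
      simp only [mul_add] at this
      rw [← mul_assoc z⁻¹ z, hz, one_mul, ← mul_assoc, hginv, mul_sub, ← mul_assoc, ← mul_assoc g⁻¹ g,
        unitri.inv_mul_self hu hg, one_mul] at this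
      exact this
    ext i j
    simp only [strictUpper, of_apply]
    split_ifs with hij
    · have e2 := congrFun (congrFun e1 i) j
      rw [Matrix.add_apply, hClow i j hij, add_zero, Matrix.sub_apply, gradingMatrix,
        diagonal_apply_ne _ hij.ne, sub_zero] at e2
      exact e2
    · rw [Matrix.mul_apply]
      refine Finset.sum_eq_zero fun k _ => ?_
      rcases lt_or_ge k i with hk | hk
      · rw [(unitri.inv hi h.right_mem.2).1 hk, zero_mul]
      · rw [hZup k j ((not_lt.1 hij).trans hk), mul_zero]
  have hxS : x * strictUpper (g⁻¹ * gradingMatrix n * g) = xu * Z' := by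
    rw [← hS, h.eq_mul, mul_assoc, ← mul_assoc z, unitri.mul_inv_self hi h.right_mem.2, one_mul]
  rw [hxS]
  refine hasDerivAt_pi.2 fun i => hasDerivAt_pi.2 fun j => ?_
  have e1 := hasDerivAt_matrix_mul (hconst xu) hZd i j
  rw [zero_mul, zero_add] at e1
  refine e1.congr_of_eventuallyEq ?_
  filter_upwards [hpos] with τ hτ
  rw [(key τ hτ).2.2.2]

lemma FiberFactor.psi_eq (h : FiberFactor u xu x c a l z) :
    psi u xu x = x * strictUpper ((l * z)⁻¹ * gradingMatrix n * (l * z)) :=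
  HasDerivAt.deriv (F := Fin n → Fin n → ℝ) h.hasDerivAt_rho

lemma FiberFactor.differentiableAt_rho (h : FiberFactor u xu x c a l z) :
    DifferentiableAt ℝ (fun τ => rho u xu (scale τ x)) 1 :=
  HasDerivAt.differentiableAt (F := Fin n → Fin n → ℝ) h.hasDerivAt_rho

/-! ### The derivative of `str` -/

lemma lineDeriv_str (x v : Mat n) : lineDeriv ℝ str x v = str v := by
  have h : ∀ t : ℝ, str (x + t • v) = str x + t * str v := by
    intro t
    simp only [str, Finset.mul_sum, ← Finset.sum_add_distrib]
    refine Finset.sum_congr rfl fun i _ => ?_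
    split_ifs
    · rw [Matrix.add_apply, Matrix.smul_apply, smul_eq_mul]
    · rw [mul_zero, add_zero]
  refine HasLineDerivAt.lineDeriv ?_
  rw [HasLineDerivAt]
  simp only [h]
  simpa using ((hasDerivAt_id (0 : ℝ)).mul_const (str v)).const_add (str x)

/-- On the first superdiagonal only the unit diagonal of `x` meets a strictly upper factor. -/
lemma str_mul_strictUpper (hx : x ∈ N n) (A : Mat n) : str (x * strictUpper A) = str A := by
  refine Finset.sum_congr rfl fun i _ => ?_
  split_ifs with h
  · have hlt : i < (⟨i + 1, h⟩ : Fin n) := Nat.lt_succ_self _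
    rw [Matrix.mul_apply, Finset.sum_eq_single i]
    · rw [hx.2, one_mul, strictUpper, of_apply, if_pos hlt]
    · intro k _ hk
      rcases lt_or_gt_of_ne hk with hk | hk
      · rw [hx.1 _ _ hk, zero_mul]
      · rw [strictUpper, of_apply, if_neg, mul_zero]
        exact not_lt.2 (Nat.succ_le_of_lt hk)
    · simp
  · rfl

lemma FiberFactor.conj_grading_apply (h : FiberFactor u xu x c a l z) {i j : Fin n}
    (hij : i ≠ j) : ((l * z)⁻¹ * gradingMatrix n * (l * z)) i j
      = ∑ p, a⁻¹ (u i) p * a p (u j) * (invVal u (u i) + 1 / 2 - invVal u p) := by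
  rw [← h.sum_eq (u.injective.ne hij) 0, ← Equiv.sum_comp u, Matrix.mul_apply]
  refine Finset.sum_congr rfl fun k _ => ?_
  have : invVal u (u k) = (k : ℕ) := by simp [invVal]
  rw [gradingMatrix, mul_diagonal, h.inv_apply, h.mul_apply, this, zero_sub]

lemma invVal_apply_succ (i : Fin n) (hi : i.val + 1 < n) :
    invVal u (u ⟨i + 1, hi⟩) = invVal u (u i) + 1 := by
  simp [invVal]

lemma FiberFactor.superdiag_nonneg (h : FiberFactor u xu x c a l z) (i : Fin n)
    (hi : i.val + 1 < n) :
    0 ≤ ((l * z)⁻¹ * gradingMatrix n * (l * z)) i ⟨i + 1, hi⟩ := by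
  rw [h.conj_grading_apply (Fin.ne_of_val_ne (Nat.lt_succ_self _).ne)]
  exact Finset.sum_nonneg fun p _ => h.term_nonneg (invVal_apply_succ i hi) p

lemma FiberFactor.str_pos (h : FiberFactor u xu x c a l z) (hne : x ≠ xu) :
    0 < str ((l * z)⁻¹ * gradingMatrix n * (l * z)) := by
  obtain ⟨p, r, hpr, ha⟩ : ∃ p r : Fin n, u⁻¹ p < u⁻¹ r ∧ a p r ≠ 0 := by
    by_contra hcon
    push Not at hcon
    exact hne (h.eq_of_right_eq_one (h.right_eq_one hcon))
  obtain ⟨q, r', hqr, hterm⟩ := h.exists_term_ne_zero hpr ha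
  have hval : ((u⁻¹ r' : Fin n) : ℕ) = (u⁻¹ q : Fin n) + 1 := by
    unfold invVal at hqr
    exact_mod_cast hqr
  have hlt : (u⁻¹ q : Fin n).val + 1 < n := hval ▸ (u⁻¹ r').2
  have hr' : u ⟨(u⁻¹ q : Fin n) + 1, hlt⟩ = r' := by
    rw [← Equiv.Perm.eq_inv_iff_eq]
    exact Fin.ext hval.symm
  have hq : u (u⁻¹ q) = q := u.apply_symm_apply q
  refine Finset.sum_pos' (fun i _ => ?_) ⟨u⁻¹ q, Finset.mem_univ _, ?_⟩
  · split_ifs with hi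
    · exact h.superdiag_nonneg i hi
    · exact le_rfl
  · rw [dif_pos hlt, h.conj_grading_apply (Fin.ne_of_val_ne (Nat.lt_succ_self _).ne), hr', hq]
    -- The half-integer weight never vanishes, so a nonzero product of entries yields a strictly
    -- positive term.
    refine Finset.sum_pos' (fun p _ => h.term_nonneg hqr p) ⟨p, Finset.mem_univ _, ?_⟩
    exact lt_of_le_of_ne (h.term_nonneg hqr p)
      (mul_ne_zero hterm (invVal_add_half_sub_ne_zero q p)).symm

lemma FiberFactor.lineDeriv_str_psi_pos (h : FiberFactor u xu x c a l z) (hne : x ≠ xu) :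
    0 < lineDeriv ℝ str x (psi u xu x) := by
  have hx : x ∈ N n := h.eq_mul ▸ unitri.mul Function.injective_id h.base_mem h.right_mem.2
  rw [lineDeriv_str, h.psi_eq, str_mul_strictUpper hx]
  exact h.str_pos hne

lemma FiberFactor.psi_base (h : FiberFactor u xu xu c a l z) : psi u xu xu = 0 := by
  have hi := Function.injective_id (α := Fin n)
  have hz : z = 1 := by
    calc z = xu⁻¹ * (xu * z) := by
          rw [← mul_assoc, unitri.inv_mul_self hi h.base_mem, one_mul]
      _ = 1 := by rw [← h.eq_mul, unitri.inv_mul_self hi h.base_mem]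
  have hlow : BlockTriangular (l⁻¹ * gradingMatrix n * l) OrderDual.toDual :=
    ((unitri.inv toDual_inj h.left_mem.2).1.mul (blockTriangular_diagonal _)).mul h.left_mem.2.1
  rw [h.psi_eq, hz, mul_one]
  have : strictUpper (l⁻¹ * gradingMatrix n * l) = 0 := by
    ext i j
    simp only [strictUpper, of_apply, Matrix.zero_apply]
    split_ifs with hij
    · exact hlow hij
    · rfl
  rw [this, mul_zero]

end

end TNNLink

end

/-! ### Well-definedness, zeros and positivity of the vector field -/

theorem lemma5p4 {n : ℕ} (u : Equiv.Perm (Fin n)) (xu : TNNLink.Mat n)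
    (hxu : xu ∈ TNNLink.Ycell u) :
    -- the vector field is well defined on the fiber
    (∀ x ∈ TNNLink.fiber u xu,
      (∀ τ : ℝ, 0 < τ →
        TNNLink.scale τ x ∈ TNNLink.Ygeq u ∧
        ∃! m, TNNLink.IsShift u xu (TNNLink.scale τ x) m) ∧
      DifferentiableAt ℝ (fun τ : ℝ => TNNLink.rho u xu (TNNLink.scale τ x)) 1) ∧
    -- it vanishes at `xu` and nowhere else on the fiber
    {x | x ∈ TNNLink.fiber u xu ∧ TNNLink.psi u xu x = 0} = {xu} ∧
    -- the derivative of `str` along it is positive at every other point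
    (∀ x ∈ TNNLink.fiber u xu, x ≠ xu →
      0 < lineDeriv ℝ TNNLink.str x (TNNLink.psi u xu x)) := by
  have hpos : ∀ x ∈ TNNLink.fiber u xu, x ≠ xu →
      0 < lineDeriv ℝ TNNLink.str x (TNNLink.psi u xu x) := by
    intro x hx hne
    obtain ⟨c, a, l, z, h⟩ := TNNLink.exists_fiberFactor hx
    exact h.lineDeriv_str_psi_pos hne
  refine ⟨fun x hx => ?_, ?_, hpos⟩
  · obtain ⟨c, a, l, z, h⟩ := TNNLink.exists_fiberFactor hx
    refine ⟨fun τ hτ => ⟨TNNLink.scale_mem_Ygeq hτ hx.1, ?_⟩, h.differentiableAt_rho⟩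
    obtain ⟨m, -, w, -, -, hm, huniq, -⟩ := h.exists_shift hτ
    exact ⟨m, hm, huniq⟩
  · ext x
    constructor
    · rintro ⟨hx, hpsi⟩
      by_contra hne
      have := hpos x hx hne
      rw [hpsi, lineDeriv_zero] at this
      exact lt_irrefl _ this
    · rintro rfl
      have hb := TNNLink.base_mem_fiber hxu
      obtain ⟨c, a, l, z, h⟩ := TNNLink.exists_fiberFactor hb
      exact ⟨hb, h.psi_base⟩
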